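/- Fix integers $\lambda,\mu\ge 1$ and $\alpha\in(0,1)$. There are $n$ papers and an even number $m$ of reviewers; $\mathcal J\subseteq[n]$ is the set of papers with the property of interest, $\overline{\mathcal J}=[n]\setminus\mathcal J$, and $w_j=1$ if $j\in\mathcal J$, $w_j=-1$ otherwise. Reviewer $i$, if assigned paper $j$, accepts it with probability $\pi^{(\mathrm{sb})}_{ij}$ in the single-blind (SB) condition and $\pi^{(\mathrm{db})}_{ij}$ in the double-blind (DB) condition. Decisions of different reviewers are independent; those of one reviewer on different papers may be arbitrarily dependent. *Absolute bias problem.* $H_0$: $\pi^{(\mathrm{sb})}_{ij}=\pi^{(\mathrm{db})}_{ij}$ for all $i,j$. $H_1$: $\pi^{(\mathrm{sb})}_{ij}\ge\pi^{(\mathrm{db})}_{ij}$ for all $i$ and all $j\in\mathcal J$, and $\pi^{(\mathrm{sb})}_{ij}\le\pi^{(\mathrm{db})}_{ij}$ for all $i$ and all $j\in\overline{\mathcal J}$, with at least one strict inequality. $H_1$ holds with margin $\delta$ if moreover $|\pi^{(\mathrm{sb})}_{ij}-\pi^{(\mathrm{db})}_{ij}|>\delta$ for all $i,j$. *Experiment.*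 The reviewers are split uniformly at random into an SB half and a DB half. For each half independently, an assignment of papers to the reviewers of that half is drawn uniformly from all those giving each paper exactly $\lambda$ reviewers and each reviewer at most $\mu$ papers (it is assumed that such assignments exist). Let $G$ be the graph joining reviewers to their assigned papers. A set of triples (SB reviewer, paper, DB reviewer) is chosen, without looking at the decisions, as follows. - If $\lambda\ge\mu$ (exact matching): draw a uniformly random maximum-cardinality matching between SB reviewers and papers in $G$, and independently one between DB reviewers and papers; take all triples $(i_1,j,i_2)$ such that $j$ is matched to $i_1$ and to $i_2$. - If $\lambda<\mu$ (greedy matching): repeatedly draw a uniformly random path $(i_1,j,i_2)$ in $G$ with $j\in\mathcal J$ (if one exists), then a uniformly random path $(i_1',j',i_2')$ with $j'\in\overline{\mathcal J}$, $i_1'\ne i_1$ and $i_2'\ne i_2$ (if one exists); add the triples found and delete their reviewers from $G$. Stop when neither is found. Each triple $(i_1,j,i_2)$ gives a tuple $(j,Y,X,w_j)$, where $Y,X\in\{0,1\}$ are the decisions of $i_1$ (SB) and $i_2$ (DB) on $j$; $\mathcal T$ is the resulting collection of tuples (counted with multiplicity). *Disagreement test.* Let $U$ (respectively $V$) be the array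 of the values $Y$ over tuples of $\mathcal T$ with $Y\ne X$ and $w=1$ (respectively $w=-1$). Reject $H_0$ if and only if both arrays are non-empty and the two-sided permutation test based on the difference $\tau$ of the means of $U$ and $V$ rejects at level $\alpha$, i.e. the proportion of permutations of the concatenated array whose statistic has absolute value at least $|\tau|$ is at most $\alpha$. *Counting test.* Let $U$ (respectively $V$) be the array of the values $Y-X$ over tuples of $\mathcal T$ with $w=1$ (respectively $w=-1$), and let $\gamma$ be the difference of the means of $U$ and $V$. Reject $H_0$ if and only if both arrays are non-empty and $|\gamma|>\sqrt{2(|U|^{-1}+|V|^{-1})\log(2/\alpha)}$. **Proposition.** Each of the two tests has the following properties. 1. (Type-I error control) For all $m,n,\mathcal J$, whenever $H_0$ holds, the test rejects with probability at most $\alpha$. 2. (Non-trivial power) For all $\varepsilon,\delta>0$ there is $n_0$, depending only on $\varepsilon,\delta,\lambda,\mu,\alpha$, such that for all $m,n,\mathcal J$ with $\min\{|\mathcal J|,|\overline{\mathcal J}|\}>n_0$, whenever $H_1$ holds with margin $\delta$, the test rejects with probability at least $1-\varepsilon$. -/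

import Mathlib

namespace PeerReview

noncomputable section

/-! ## Generic randomness -/

/-- A uniformly random element of the finite set `s` (a fixed value if `s` is empty). -/
def uniformOn {β : Type} [Inhabited β] (s : Finset β) : PMF β :=
  open Classical in
  if h : s.Nonempty then PMF.uniformOfFinset s h else PMF.pure default

/-- A uniformly random element of the finite set `s`, or `none` if `s` is empty. -/
def uniformOption {β : Type} (s : Finset β) : PMF (Option β) :=
  open Classical in
  if h : s.Nonempty then (PMF.uniformOfFinset s h).map some else PMF.pure none

/-- The joint law of independent rows, the `i`-th row having law `ρ i`. -/
def indepRows {m n : ℕ} (ρ : Fin m → PMF (Fin n → Bool)) : PMF (Fin m → Fin n → Bool) :=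
  PMF.ofFintype (fun D => ∏ i, ρ i (D i)) (by
    rw [← Fintype.prod_sum (fun i (d : Fin n → Bool) => ρ i d)]
    refine Finset.prod_eq_one fun i _ => ?_
    rw [← tsum_fintype (L := SummationFilter.unconditional _)]
    exact (ρ i).tsum_coe)

/-! ## The statistical tests -/

/-- The data `(j, Y, X, w)` contributed by one pair of an SB and a DB reviewer of a common paper:
the paper, the SB decision, the DB decision (`true` is accept), and the indicator `w = ±1`. -/
structure ReviewTuple (n : ℕ) where
  paper : Fin n
  Y : Bool
  X : Bool
  w : ℤ

/-- A (non-randomized) test: for a finite family of tuples, the proposition that the null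
is rejected. -/
abbrev StatTest : Type 1 :=
  (n : ℕ) → (κ : Type) → [Fintype κ] → (κ → ReviewTuple n) → Prop

/-- A decision as a number in `{0, 1}`. -/
def dec (b : Bool) : ℝ := if b then 1 else 0

/-- The arithmetic mean of a finite array. -/
def avg {ι : Type} [Fintype ι] (u : ι → ℝ) : ℝ := (∑ i, u i) / Fintype.card ι

/-- Difference of the means of the two parts of a concatenated array. -/
def meanDiff {ι κ : Type} [Fintype ι] [Fintype κ] (z : ι ⊕ κ → ℝ) : ℝ :=
  avg (fun i => z (Sum.inl i)) - avg (fun k => z (Sum.inr k))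

/-- The p-value of the two-sided permutation test for exchangeability of the entries of `u` and
`v`: the proportion of permutations of the concatenated array for which the absolute value of the
statistic is at least the observed one. -/
def permPValue {ι κ : Type} [Fintype ι] [Fintype κ] (u : ι → ℝ) (v : κ → ℝ) : ℝ :=
  open Classical in
  (((Finset.univ : Finset (Equiv.Perm (ι ⊕ κ))).filter
      (fun σ => |meanDiff (Sum.elim u v)| ≤ |meanDiff (fun x => Sum.elim u v (σ x))|)).card : ℝ) /
    Fintype.card (Equiv.Perm (ι ⊕ κ))

/-- The Disagreement test at level `α`. -/
def disagreementTest (α : ℝ) : StatTest := fun _ κ _ t =>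
  open Classical in
  let u : {k : κ // (t k).Y ≠ (t k).X ∧ (t k).w = 1} → ℝ := fun k => dec (t k).Y
  let v : {k : κ // (t k).Y ≠ (t k).X ∧ (t k).w = -1} → ℝ := fun k => dec (t k).Y
  (∃ k, (t k).Y ≠ (t k).X ∧ (t k).w = 1) ∧ (∃ k, (t k).Y ≠ (t k).X ∧ (t k).w = -1) ∧
    permPValue u v ≤ α

/-- The Counting test at level `α`. -/
def countingTest (α : ℝ) : StatTest := fun _ κ _ t =>
  open Classical in
  let u : {k : κ // (t k).w = 1} → ℝ := fun k => dec (t k).Y - dec (t k).X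
  let v : {k : κ // (t k).w = -1} → ℝ := fun k => dec (t k).Y - dec (t k).X
  (∃ k, (t k).w = 1) ∧ (∃ k, (t k).w = -1) ∧
    Real.sqrt (2 * ((Fintype.card {k : κ // (t k).w = 1} : ℝ)⁻¹
      + (Fintype.card {k : κ // (t k).w = -1} : ℝ)⁻¹) * Real.log (2 / α)) < |avg u - avg v|

/-! ## Assignments -/

/-- An assignment: the set of pairs (reviewer, paper) such that the reviewer is assigned
the paper. -/
abbrev Assignment (m n : ℕ) := Finset (Fin m × Fin n)

/-- The papers assigned to reviewer `i`. -/
def papersOf {m n : ℕ} (A : Assignment m n) (i : Fin m) : Finset (Fin n) :=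
  Finset.univ.filter (fun j => (i, j) ∈ A)

/-- The reviewers to whom paper `j` is assigned. -/
def reviewersOf {m n : ℕ} (A : Assignment m n) (j : Fin n) : Finset (Fin m) :=
  Finset.univ.filter (fun i => (i, j) ∈ A)

/-- The assignments of the `n` papers to the reviewers of the group `R` that satisfy the
load constraints: each paper gets `lam` reviewers, each reviewer gets at most `mu` papers. -/
def validAssignments {m : ℕ} (n lam mu : ℕ) (R : Finset (Fin m)) : Finset (Assignment m n) :=
  open Classical in
  Finset.univ.filter (fun A =>
    (∀ e ∈ A, e.1 ∈ R) ∧ (∀ j, (reviewersOf A j).card = lam) ∧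
      (∀ i, (papersOf A i).card ≤ mu))

/-- The groups consisting of half of the reviewers. -/
def halves (m : ℕ) : Finset (Finset (Fin m)) :=
  Finset.univ.filter (fun R => 2 * R.card = m)

/-- The experiment can be carried out: some half of the reviewers (equivalently, each half)
admits an assignment that satisfies the load constraints. -/
def Feasible (m n lam mu : ℕ) : Prop :=
  ∃ R ∈ halves m, (validAssignments n lam mu R).Nonempty

/-! ## The matching procedures

A triple `(i₁, j, i₂)` consists of an SB reviewer, a paper and a DB reviewer. -/

abbrev Triple (m n : ℕ) := Fin m × Fin n × Fin m

/-- The paths `i₁ – j – i₂` in the three-layer graph with edges `A_SB` and `A_DB`. -/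
def paths {m n : ℕ} (ASB ADB : Assignment m n) : Finset (Triple m n) :=
  Finset.univ.filter (fun t => (t.1, t.2.1) ∈ ASB ∧ (t.2.2, t.2.1) ∈ ADB)

/-- `M` matches each reviewer to at most one paper and each paper to at most one reviewer. -/
def IsMatching {m n : ℕ} (M : Assignment m n) : Prop :=
  ∀ e ∈ M, ∀ e' ∈ M, e.1 = e'.1 ∨ e.2 = e'.2 → e = e'

/-- The matchings of maximum cardinality among those contained in the bipartite graph `A`. -/
def maximumMatchings {m n : ℕ} (A : Assignment m n) : Finset (Assignment m n) :=
  open Classical in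
  Finset.univ.filter (fun M => M ⊆ A ∧ IsMatching M ∧
    ∀ M' : Assignment m n, M' ⊆ A → IsMatching M' → M'.card ≤ M.card)

/-- Exact matching algorithm: independent, uniformly random maximum matchings of the papers to the
SB and to the DB reviewers, joined along the papers. -/
def exactMatching {m n : ℕ} (ASB ADB : Assignment m n) : PMF (Finset (Triple m n)) :=
  (uniformOn (maximumMatchings ASB)).bind fun MSB =>
  (uniformOn (maximumMatchings ADB)).bind fun MDB =>
  PMF.pure (paths MSB MDB)

/-- Delete the reviewers of the optional triple `t` with their edges. -/
def deleteReviewers {m n : ℕ} (t : Option (Triple m n)) (A : Assignment m n) : Assignment m n :=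
  A.filter (fun e => ∀ s ∈ t, e.1 ≠ s.1 ∧ e.1 ≠ s.2.2)

/-- The iterations of the greedy matching algorithm, started from the graph `(ASB, ADB)` and the
set `T`, and at most `fuel` of them. -/
def greedyLoop {m n : ℕ} (J : Finset (Fin n)) :
    ℕ → Assignment m n → Assignment m n → Finset (Triple m n) → PMF (Finset (Triple m n))
  | 0, _, _, T => PMF.pure T
  | fuel + 1, ASB, ADB, T =>
    (uniformOption ((paths ASB ADB).filter (fun t => t.2.1 ∈ J))).bind fun t₁ =>
    (uniformOption ((paths ASB ADB).filter (fun t =>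
        t.2.1 ∉ J ∧ ∀ s ∈ t₁, t.1 ≠ s.1 ∧ t.2.2 ≠ s.2.2))).bind fun t₂ =>
    if t₁ = none ∧ t₂ = none then PMF.pure T
    else greedyLoop J fuel
      (deleteReviewers t₁ (deleteReviewers t₂ ASB))
      (deleteReviewers t₁ (deleteReviewers t₂ ADB))
      (T ∪ t₁.toFinset ∪ t₂.toFinset)

/-- Greedy matching algorithm. Each iteration that does not terminate deletes at least one edge of
`ASB`, so that `ASB.card` iterations always suffice. -/
def greedyMatching {m n : ℕ} (J : Finset (Fin n)) (ASB ADB : Assignment m n) :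
    PMF (Finset (Triple m n)) :=
  greedyLoop J ASB.card ASB ADB ∅

/-- The procedure `𝒜`: exact matching if `lam ≥ mu`, greedy matching if `lam < mu`. -/
def matchingProcedure {m n : ℕ} (lam mu : ℕ) (J : Finset (Fin n)) (ASB ADB : Assignment m n) :
    PMF (Finset (Triple m n)) :=
  if mu ≤ lam then exactMatching ASB ADB else greedyMatching J ASB ADB

/-! ## Reviewers' decisions and the bias testing problem -/

/-- The two conditions: single blind and double blind. -/
inductive Condition
  | sb
  | db

/-- The behaviour of the reviewers: for every reviewer, condition and set of papers assigned to the
reviewer, the joint law of the reviewer's decisions (only those on assigned papers matter). The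
decisions of one reviewer on different papers may be arbitrarily dependent. -/
abbrev Behaviour (m n : ℕ) := Fin m → Condition → Finset (Fin n) → PMF (Fin n → Bool)

/-- Reviewer `i` accepts paper `j`, if assigned to him, with probability `Psb i j` in the SB and
`Pdb i j` in the DB condition. -/
def Behaviour.HasAcceptProbs {m n : ℕ} (B : Behaviour m n)
    (Psb Pdb : Matrix (Fin m) (Fin n) unitInterval) : Prop :=
  ∀ i, ∀ S : Finset (Fin n), ∀ j ∈ S,
    (B i Condition.sb S).map (fun d => d j) true = ENNReal.ofReal (Psb i j) ∧
    (B i Condition.db S).map (fun d => d j) true = ENNReal.ofReal (Pdb i j)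

/-- The null hypothesis of the absolute bias problem. -/
def NullHypothesis {m n : ℕ} (Psb Pdb : Matrix (Fin m) (Fin n) unitInterval) : Prop :=
  ∀ i j, Psb i j = Pdb i j

/-- The alternative hypothesis of the absolute bias problem. -/
def Alternative {m n : ℕ} (J : Finset (Fin n))
    (Psb Pdb : Matrix (Fin m) (Fin n) unitInterval) : Prop :=
  (∀ i j, (j ∈ J → Pdb i j ≤ Psb i j) ∧ (j ∉ J → Psb i j ≤ Pdb i j)) ∧
    ∃ i j, (j ∈ J ∧ Pdb i j < Psb i j) ∨ (j ∉ J ∧ Psb i j < Pdb i j)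

/-- The alternative hypothesis holds with margin `δ`. -/
def AlternativeWithMargin {m n : ℕ} (J : Finset (Fin n)) (δ : ℝ)
    (Psb Pdb : Matrix (Fin m) (Fin n) unitInterval) : Prop :=
  Alternative J Psb Pdb ∧ ∀ i j, δ < |(Psb i j : ℝ) - (Pdb i j : ℝ)|

/-! ## The experiment -/

/-- The joint law of all decisions, given the group `R` of SB reviewers and the assignments:
the reviewers are independent. -/
def decisionLaw {m n : ℕ} (B : Behaviour m n) (R : Finset (Fin m)) (ASB ADB : Assignment m n) :
    PMF (Fin m → Fin n → Bool) :=
  indepRows fun i =>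
    if i ∈ R then B i Condition.sb (papersOf ASB i) else B i Condition.db (papersOf ADB i)

/-- The tuples that correspond to the set `T` of triples when the decisions are `D`. -/
def tuplesOf {m n : ℕ} (J : Finset (Fin n)) (D : Fin m → Fin n → Bool) (T : Finset (Triple m n)) :
    T → ReviewTuple n := fun t =>
  { paper := t.1.2.1
    Y := D t.1.1 t.1.2.1
    X := D t.1.2.2 t.1.2.1
    w := if t.1.2.1 ∈ J then 1 else -1 }

/-- The law of the outcome (`true` is rejection) of the experiment: split the reviewers into an SB
half and a DB half uniformly at random; choose uniformly random assignments within both groups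
among those that satisfy the load constraints; run the matching procedure; observe the decisions;
apply the test. -/
def experiment {m n : ℕ} (lam mu : ℕ) (J : Finset (Fin n)) (B : Behaviour m n)
    (test : StatTest) : PMF Bool :=
  (uniformOn (halves m)).bind fun R =>
  (uniformOn (validAssignments n lam mu R)).bind fun ASB =>
  (uniformOn (validAssignments n lam mu Rᶜ)).bind fun ADB =>
  (matchingProcedure lam mu J ASB ADB).bind fun T =>
  (decisionLaw B R ASB ADB).bind fun D =>
  open Classical in PMF.pure (decide (test n T (tuplesOf J D T)))

/-- The probability that the null hypothesis is rejected. -/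
def rejectProb {m n : ℕ} (lam mu : ℕ) (J : Finset (Fin n)) (B : Behaviour m n)
    (test : StatTest) : ℝ :=
  (experiment lam mu J B test true).toReal

/-- Control of the Type-I error at level `α`. -/
def ControlsTypeI (lam mu : ℕ) (α : ℝ) (test : StatTest) : Prop :=
  ∀ (m n : ℕ), Even m → Feasible m n lam mu →
  ∀ (J : Finset (Fin n)) (Psb Pdb : Matrix (Fin m) (Fin n) unitInterval),
  NullHypothesis Psb Pdb →
  ∀ B : Behaviour m n, B.HasAcceptProbs Psb Pdb → rejectProb lam mu J B test ≤ α

/-- Non-trivial power. -/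
def NonTrivialPower (lam mu : ℕ) (test : StatTest) : Prop :=
  ∀ ε : ℝ, 0 < ε → ∀ δ : ℝ, 0 < δ → ∃ n₀ : ℕ,
  ∀ (m n : ℕ), Even m → Feasible m n lam mu →
  ∀ (J : Finset (Fin n)), n₀ < min J.card Jᶜ.card →
  ∀ (Psb Pdb : Matrix (Fin m) (Fin n) unitInterval), AlternativeWithMargin J δ Psb Pdb →
  ∀ B : Behaviour m n, B.HasAcceptProbs Psb Pdb → 1 - ε ≤ rejectProb lam mu J B test

end

end PeerReview

/-! The two reviewers of a triple may have different acceptance probabilities. So, given the triple,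
`Y` and `X` need not be exchangeable under the null hypothesis, and the mean of `Y - X` may have the
wrong sign under the alternative. The remedy is the randomness of the experiment. The law of the set
of triples is invariant under renaming the reviewers (`tripleLaw_relabel`). As all reviewers in the
triples are distinct, exchanging the two reviewers within any selected triples agrees with such a
renaming, and the law is invariant under these exchanges too (`tripleLaw_exchange`). Averaging over
independent fair exchanges, one may compute as if, given the triples, the pairs `(Y, X)` were
independent with weights `symmWeight` (`rejectProb_eq_expect_symm`). Distinctness also makes the
dependence among the decisions of one reviewer irrelevant (`expect_decisionLaw`).

Under the null hypothesis the symmetrized weights are symmetric in the two decisions, so each pair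
may be swapped by a fair coin. It then suffices that the test has level `α` under such swaps of
fixed tuples (`HasSwapLevel`). For the Disagreement test, the values `Y` at disagreements become
independent fair coins, hence exchangeable, and the permutation test is valid. For the Counting
test, the statistic becomes a sum with random signs, and Hoeffding's inequality applies.

Under the alternative with margin, the symmetrized mean of `Y - X` averages, over the two reviewers,
the gap between SB and DB on the same paper, so it has the right sign and size more than `δ`. The
matchings yield a number of triples of each kind that grows linearly with the number of papers of
that kind: by Hall's theorem for exact matching, by counting the papers lost per round for greedy
matching. The Chernoff bound `lower_tail` then makes both sums of differences large, and large clear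
sums force rejection deterministically (`RejectsBias`): the threshold of the Counting test tends to
zero, and the p-value is small by Chebyshev. -/

namespace PeerReview

noncomputable section

/-! ## Finite expectations -/

/-- The expectation of a real function on a finite probability space. -/
def expect {α : Type} [Fintype α] (p : PMF α) (f : α → ℝ) : ℝ := ∑ a, (p a).toReal * f a

theorem sum_toReal {α : Type} [Fintype α] (p : PMF α) : ∑ a, (p a).toReal = 1 := by
  rw [← ENNReal.toReal_sum fun a _ => p.apply_ne_top a,
    ← tsum_fintype (L := SummationFilter.unconditional _), p.tsum_coe, ENNReal.toReal_one]

theorem expect_bind {α β : Type} [Fintype α] [Fintype β] (p : PMF α) (q : α → PMF β)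
    (f : β → ℝ) : expect (p.bind q) f = expect p fun a => expect (q a) f := by
  have key : ∀ b, ((p.bind q) b).toReal = ∑ a, (p a).toReal * (q a b).toReal := fun b => by
    rw [PMF.bind_apply, tsum_fintype, ENNReal.toReal_sum fun a _ =>
      ENNReal.mul_ne_top (p.apply_ne_top a) ((q a).apply_ne_top b)]
    simp only [ENNReal.toReal_mul]
  simp only [expect, key, Finset.sum_mul, Finset.mul_sum]
  rw [Finset.sum_comm]
  simp only [mul_assoc]

theorem expect_pure {α : Type} [Fintype α] (a : α) (f : α → ℝ) :
    expect (PMF.pure a) f = f a := by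
  classical
  rw [expect, Finset.sum_eq_single a]
  · simp
  · intro b _ hb
    simp [PMF.pure_apply, hb]
  · simp

theorem expect_congr {α : Type} [Fintype α] (p : PMF α) {f g : α → ℝ}
    (h : ∀ a ∈ p.support, f a = g a) : expect p f = expect p g := by
  refine Finset.sum_congr rfl fun a _ => ?_
  by_cases ha : a ∈ p.support
  · rw [h a ha]
  · rw [PMF.mem_support_iff, not_not] at ha
    simp [ha]

theorem expect_mono {α : Type} [Fintype α] (p : PMF α) {f g : α → ℝ}
    (h : ∀ a ∈ p.support, f a ≤ g a) : expect p f ≤ expect p g := by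
  refine Finset.sum_le_sum fun a _ => ?_
  by_cases ha : a ∈ p.support
  · exact mul_le_mul_of_nonneg_left (h a ha) ENNReal.toReal_nonneg
  · rw [PMF.mem_support_iff, not_not] at ha
    simp [ha]

theorem expect_const {α : Type} [Fintype α] (p : PMF α) (c : ℝ) :
    expect p (fun _ => c) = c := by
  rw [expect, ← Finset.sum_mul, sum_toReal, one_mul]

theorem toReal_bool_true (p : PMF Bool) :
    (p true).toReal = expect p fun b => if b then 1 else 0 := by
  simp [expect]

/-! ## Product weights -/

section Product

variable {ι I X : Type} [Fintype ι] [Fintype I] [DecidableEq I] [Fintype X]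

/-- Under a product weight, functions of distinct coordinates are uncorrelated. -/
theorem sum_prod_mul_prod_comp {r : ι → I} (hr : Function.Injective r) (ρ : I → X → ℝ)
    (hρ : ∀ i, ∑ x, ρ i x = 1) (g : ι → X → ℝ) :
    ∑ D : I → X, (∏ i, ρ i (D i)) * ∏ k, g k (D (r k)) = ∏ k, ∑ x, ρ (r k) x * g k x := by
  classical
  have h1 : ∀ D : I → X, (∏ i, ρ i (D i)) * ∏ k, g k (D (r k)) =
      ∏ i, (ρ i (D i) * ∏ k with r k = i, g k (D i)) := fun D => by
    rw [Finset.prod_mul_distrib, ← Finset.prod_fiberwise Finset.univ r]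
    congr 1
    refine Finset.prod_congr rfl fun i _ => Finset.prod_congr rfl fun k hk => ?_
    rw [(Finset.mem_filter.1 hk).2]
  rw [Finset.sum_congr rfl fun D _ => h1 D,
    ← Fintype.prod_sum fun i x => ρ i x * ∏ k with r k = i, g k x,
    ← Finset.prod_fiberwise Finset.univ r fun k => ∑ x, ρ (r k) x * g k x]
  refine Finset.prod_congr rfl fun i _ => ?_
  by_cases hi : ∃ k, r k = i
  · obtain ⟨k, rfl⟩ := hi
    have : (Finset.univ.filter fun l => r l = r k) = {k} := by
      ext l
      simp [hr.eq_iff]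
    simp [this]
  · have : (Finset.univ.filter fun l => r l = i) = ∅ := by
      ext l
      simpa using fun h => hi ⟨l, h⟩
    simp [this, hρ]

/-- The image of a product weight under a map that acts on distinct coordinates is the product of
the images. -/
theorem sum_prod_mul_comp {Z : Type} [Fintype Z] [DecidableEq Z] [DecidableEq ι]
    {r : ι → I} (hr : Function.Injective r) (ρ : I → X → ℝ)
    (hρ : ∀ i, ∑ x, ρ i x = 1) (ψ : ι → X → Z) (G : (ι → Z) → ℝ) :
    ∑ D : I → X, (∏ i, ρ i (D i)) * G (fun k => ψ k (D (r k))) =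
      ∑ z : ι → Z, (∏ k, ∑ x, ρ (r k) x * if ψ k x = z k then 1 else 0) * G z := by
  have h1 : ∀ D : I → X, G (fun k => ψ k (D (r k))) =
      ∑ z : ι → Z, (∏ k, if ψ k (D (r k)) = z k then (1 : ℝ) else 0) * G z := fun D => by
    rw [Finset.sum_eq_single fun k => ψ k (D (r k))]
    · simp
    · intro z _ hz
      obtain ⟨k, hk⟩ := Function.ne_iff.1 hz
      rw [Finset.prod_eq_zero (Finset.mem_univ k) (if_neg hk.symm), zero_mul]
    · simp
  simp only [h1, Finset.mul_sum]
  rw [Finset.sum_comm]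
  refine Finset.sum_congr rfl fun z _ => ?_
  rw [← sum_prod_mul_prod_comp hr ρ hρ fun k x => if ψ k x = z k then 1 else 0, Finset.sum_mul]
  simp only [mul_assoc]

theorem sum_prod_eq_one (ρ : I → X → ℝ) (hρ : ∀ i, ∑ x, ρ i x = 1) :
    ∑ D : I → X, ∏ i, ρ i (D i) = 1 := by
  rw [← Fintype.prod_sum]
  simp [hρ]

/-- A Chernoff bound: a sum of independent variables with values in `[-1, 1]` and means at least
`d` is unlikely to be less than half of the lower bound `d * |S|` of its mean. -/
theorem lower_tail (ρ : I → X → ℝ) (hρ0 : ∀ i x, 0 ≤ ρ i x)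
    (hρ : ∀ i, ∑ x, ρ i x = 1) (h : I → X → ℝ) (hh : ∀ i x, |h i x| ≤ 1) (S : Finset I)
    {d : ℝ} (hd0 : 0 < d) (hd1 : d ≤ 1) (hm : ∀ i ∈ S, d ≤ ∑ x, ρ i x * h i x) :
    ∑ D : I → X, (∏ i, ρ i (D i)) *
      (if ∑ i ∈ S, h i (D i) < d / 2 * S.card then 1 else 0) ≤
        Real.exp (-(d ^ 2 / 16 * S.card)) := by
  -- With tilt `d / 4` and `exp y ≤ 1 + y + y ^ 2` for `|y| ≤ 1`, each factor is at most `1 + d ^ 2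
  -- / 16 - d ^ 2 / 4`.
  have step : ∀ i ∈ S, ∑ x, ρ i x * Real.exp (-(d / 4) * h i x) ≤
      Real.exp (-(3 * d ^ 2 / 16)) := fun i hi => by
    have h2 : ∀ x, Real.exp (-(d / 4) * h i x) ≤ 1 - d / 4 * h i x + d ^ 2 / 16 := fun x => by
      have hx := abs_le.1 (hh i x)
      have hsq : h i x ^ 2 ≤ 1 := by nlinarith
      have := (abs_le.1 (Real.abs_exp_sub_one_sub_id_le (x := -(d / 4) * h i x) (by
        rw [abs_mul, abs_neg, abs_of_pos (by positivity : 0 < d / 4)]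
        nlinarith [hh i x, abs_nonneg (h i x)]))).2
      nlinarith [sq_nonneg d]
    calc ∑ x, ρ i x * Real.exp (-(d / 4) * h i x)
        ≤ ∑ x, (ρ i x * (1 + d ^ 2 / 16) - d / 4 * (ρ i x * h i x)) := by
          refine Finset.sum_le_sum fun x _ => ?_
          nlinarith [mul_le_mul_of_nonneg_left (h2 x) (hρ0 i x)]
      _ = 1 + d ^ 2 / 16 - d / 4 * ∑ x, ρ i x * h i x := by
          rw [Finset.sum_sub_distrib, ← Finset.sum_mul, hρ, ← Finset.mul_sum, one_mul]
      _ ≤ -(3 * d ^ 2 / 16) + 1 := by nlinarith [hm i hi]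
      _ ≤ _ := Real.add_one_le_exp _
  -- Exponential Markov bound: the prefactor is the tilt `d / 4` times the level `d / 2 * |S|`. The
  -- rate left over is `3 * d ^ 2 / 16 - d ^ 2 / 8 = d ^ 2 / 16`.
  have h3 : ∀ D : I → X, (if ∑ i ∈ S, h i (D i) < d / 2 * S.card then (1 : ℝ) else 0) ≤
      Real.exp (d ^ 2 / 8 * S.card) *
        ∏ i, (if i ∈ S then Real.exp (-(d / 4) * h i (D i)) else 1) := fun D => by
    rw [Finset.prod_ite_mem, Finset.univ_inter, ← Real.exp_sum, ← Finset.mul_sum, ← Real.exp_add]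
    split_ifs with hlt
    · refine Real.one_le_exp ?_
      nlinarith
    · positivity
  calc _ ≤ ∑ D : I → X, (∏ i, ρ i (D i)) * (Real.exp (d ^ 2 / 8 * S.card) *
        ∏ i, (if i ∈ S then Real.exp (-(d / 4) * h i (D i)) else 1)) :=
        Finset.sum_le_sum fun D _ =>
          mul_le_mul_of_nonneg_left (h3 D) (Finset.prod_nonneg fun i _ => hρ0 _ _)
    _ = Real.exp (d ^ 2 / 8 * S.card) *
        ∏ i, ∑ x, ρ i x * (if i ∈ S then Real.exp (-(d / 4) * h i x) else 1) := by
        have := sum_prod_mul_prod_comp Function.injective_id ρ hρ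
          fun i x => if i ∈ S then Real.exp (-(d / 4) * h i x) else 1
        simp only [id] at this
        rw [← this, Finset.mul_sum]
        refine Finset.sum_congr rfl fun D _ => ?_
        ring
    _ ≤ Real.exp (d ^ 2 / 8 * S.card) *
        ∏ i, (if i ∈ S then Real.exp (-(3 * d ^ 2 / 16)) else 1) := by
        refine mul_le_mul_of_nonneg_left (Finset.prod_le_prod (fun i _ => ?_) fun i _ => ?_)
          (Real.exp_pos _).le
        · refine Finset.sum_nonneg fun x _ => mul_nonneg (hρ0 i x) ?_
          split_ifs <;> positivity
        · split_ifs with hi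
          · exact step i hi
          · simp [hρ]
    _ = Real.exp (-(d ^ 2 / 16 * S.card)) := by
        rw [Finset.prod_ite_mem, Finset.univ_inter, Finset.prod_const, ← Real.exp_nat_mul,
          ← Real.exp_add]
        congr 1
        ring

end Product

/-- Two injective families with the same index set differ by a permutation. -/
theorem exists_perm_comp {ι I : Type} [Finite I] {g g' : ι → I} (hg : Function.Injective g)
    (hg' : Function.Injective g') : ∃ σ : Equiv.Perm I, ∀ k, σ (g k) = g' k := by
  classical
  let e : {x // x ∈ Set.range g} ≃ {x // x ∈ Set.range g'} :=
    (Equiv.ofInjective g hg).symm.trans (Equiv.ofInjective g' hg')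
  refine ⟨e.extendSubtype, fun k => ?_⟩
  rw [Equiv.extendSubtype_apply_of_mem e (g k) ⟨k, rfl⟩]
  have : (⟨g k, k, rfl⟩ : {x // x ∈ Set.range g}) = Equiv.ofInjective g hg k := rfl
  rw [this]
  simp [e]

/-! ## The permutation test -/

theorem avg_comp {ι ι' : Type} [Fintype ι] [Fintype ι'] (e : ι ≃ ι') (u : ι' → ℝ) :
    avg (fun i => u (e i)) = avg u := by
  rw [avg, avg, Equiv.sum_comp e u, Fintype.card_congr e]

theorem permPValue_comp {ι ι' κ κ' : Type} [Fintype ι] [Fintype ι'] [Fintype κ] [Fintype κ']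
    (e : ι ≃ ι') (f : κ ≃ κ') (u : ι' → ℝ) (v : κ' → ℝ) :
    permPValue (fun i => u (e i)) (fun k => v (f k)) = permPValue u v := by
  classical
  have hm : ∀ z : ι' ⊕ κ' → ℝ, meanDiff (fun x => z (Equiv.sumCongr e f x)) = meanDiff z :=
    fun z => by
      rw [meanDiff, meanDiff, ← avg_comp e fun i => z (Sum.inl i),
        ← avg_comp f fun i => z (Sum.inr i)]
      rfl
  have h0 : Sum.elim (fun i => u (e i)) (fun k => v (f k)) =
      fun x => Sum.elim u v (Equiv.sumCongr e f x) := by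
    ext x
    cases x <;> rfl
  have hc := Fintype.card_congr (Equiv.sumCongr e f).permCongr
  unfold permPValue
  rw [h0, hm]
  congr 1
  · norm_cast
    refine Finset.card_bij (fun σ _ => (Equiv.sumCongr e f).permCongr σ) (fun σ hσ => ?_)
      (fun σ _ σ' _ h => (Equiv.sumCongr e f).permCongr.injective h)
      fun σ hσ => ⟨(Equiv.sumCongr e f).permCongr.symm σ, ?_, Equiv.apply_symm_apply _ _⟩
    · simp only [Finset.mem_filter, Finset.mem_univ, true_and] at hσ ⊢
      refine hσ.trans (le_of_eq ?_)
      rw [← hm fun x => Sum.elim u v ((Equiv.sumCongr e f).permCongr σ x)]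
      simp only [Equiv.permCongr_apply, Equiv.symm_apply_apply]
    · simp only [Finset.mem_filter, Finset.mem_univ, true_and] at hσ ⊢
      refine hσ.trans (le_of_eq ?_)
      rw [← hm fun x => Sum.elim u v (σ x)]
      simp only [Equiv.permCongr_symm_apply, Equiv.apply_symm_apply]
  · exact_mod_cast hc

/-- Left translation turns the inner count into the rank of `f τ` among all values of `f`. If `τ`
has the least value among the elements counted outside, they all lie in the set whose size is the
rank of `τ`, and that rank is at most `a`. -/
theorem card_rank_le {G : Type} [Group G] [Fintype G] (f : G → ℝ) {a : ℝ} (ha : 0 ≤ a) :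
    open Classical in
    (((Finset.univ.filter fun τ : G =>
      ((Finset.univ.filter fun σ : G => f τ ≤ f (τ * σ)).card : ℝ) ≤ a).card : ℕ) : ℝ) ≤ a := by
  classical
  have hF : ∀ τ : G, (Finset.univ.filter fun σ : G => f τ ≤ f (τ * σ)).card =
      (Finset.univ.filter fun σ : G => f τ ≤ f σ).card := fun τ =>
    Finset.card_equiv (Equiv.mulLeft τ) (by simp)
  simp only [hF]
  rcases (Finset.univ.filter fun τ : G =>
    ((Finset.univ.filter fun σ : G => f τ ≤ f σ).card : ℝ) ≤ a).eq_empty_or_nonempty with h | h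
  · simpa [h] using ha
  · obtain ⟨τ, hτ, hmin⟩ := Finset.exists_min_image _ f h
    refine le_trans ?_ (Finset.mem_filter.1 hτ).2
    exact_mod_cast Finset.card_le_card fun σ hσ => by simpa using hmin σ hσ

open Classical in
/-- Validity of the permutation test for independent fair coins. -/
theorem permPValue_level {ι κ : Type} [Fintype ι] [Fintype κ] {α : ℝ} (hα : 0 ≤ α) :
    ∑ z : ι ⊕ κ → Bool, (∏ _k : ι ⊕ κ, (1 / 2 : ℝ)) *
      (if permPValue (fun i => dec (z (Sum.inl i))) (fun k => dec (z (Sum.inr k))) ≤ α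
        then 1 else 0) ≤ α := by
  set c : ℝ := ((Fintype.card (Equiv.Perm (ι ⊕ κ)) : ℕ) : ℝ)
  have hc : 0 < c := by
    simp only [c]
    exact_mod_cast Fintype.card_pos
  let S : (ι ⊕ κ → Bool) → ℝ := fun z => |meanDiff fun x => dec (z x)|
  let P : (ι ⊕ κ → Bool) → Prop := fun z =>
    ((Finset.univ.filter fun σ : Equiv.Perm (ι ⊕ κ) => S z ≤ S (fun x => z (σ x))).card : ℝ) ≤
      α * c
  have hP : ∀ z : ι ⊕ κ → Bool,
      permPValue (fun i => dec (z (Sum.inl i))) (fun k => dec (z (Sum.inr k))) ≤ α ↔ P z :=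
    fun z => by
      have : Sum.elim (fun i => dec (z (Sum.inl i))) (fun k => dec (z (Sum.inr k))) =
          fun x => dec (z x) := by
        ext x
        cases x <;> rfl
      rw [permPValue, this, div_le_iff₀ hc]
  -- For a fixed array, at most a proportion `α` of its rearrangements are rejected, since the
  -- p-value of a rearrangement is its normalized rank in the orbit.
  have hz : ∀ z : ι ⊕ κ → Bool, ∑ τ : Equiv.Perm (ι ⊕ κ), (if P (fun x => z (τ x)) then (1 : ℝ) else 0) ≤
      α * c := fun z => by
    rw [Finset.sum_boole]
    refine le_trans (Nat.cast_le.2 (Finset.card_le_card fun τ hτ => ?_))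
      (card_rank_le (fun σ : Equiv.Perm (ι ⊕ κ) => S fun x => z (σ x)) (mul_nonneg hα hc.le))
    rw [Finset.mem_filter] at hτ ⊢
    exact hτ
  -- The uniform law on Boolean arrays is permutation invariant, so averaging over rearrangements
  -- changes nothing.
  have hsum : ∀ τ : Equiv.Perm (ι ⊕ κ), ∑ z : ι ⊕ κ → Bool,
      (if P (fun x => z (τ x)) then (1 : ℝ) else 0) = ∑ z, if P z then 1 else 0 := fun τ =>
    Equiv.sum_comp (τ.symm.arrowCongr (Equiv.refl Bool)) fun z => if P z then (1 : ℝ) else 0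
  have htot : c * ∑ z, (if P z then (1 : ℝ) else 0) ≤ (2 : ℝ) ^ Fintype.card (ι ⊕ κ) * (α * c) := by
    calc c * ∑ z, (if P z then (1 : ℝ) else 0)
        = ∑ τ : Equiv.Perm (ι ⊕ κ), ∑ z : ι ⊕ κ → Bool,
            (if P (fun x => z (τ x)) then (1 : ℝ) else 0) := by
          simp [hsum, c]
      _ = ∑ z : ι ⊕ κ → Bool, ∑ τ : Equiv.Perm (ι ⊕ κ),
            (if P (fun x => z (τ x)) then (1 : ℝ) else 0) := Finset.sum_comm
      _ ≤ ∑ _z : ι ⊕ κ → Bool, α * c := Finset.sum_le_sum fun z _ => hz z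
      _ = _ := by simp
  have htot' : ∑ z, (if P z then (1 : ℝ) else 0) ≤ (2 : ℝ) ^ Fintype.card (ι ⊕ κ) * α := by
    nlinarith
  simp only [hP]
  rw [← Finset.mul_sum, Finset.prod_const, Finset.card_univ, one_div, inv_pow]
  rw [inv_mul_le_iff₀ (by positivity)]
  exact htot'

/-- Coefficients of the difference of means as a linear form. -/
def meanDiffCoeff (ι κ : Type) [Fintype ι] [Fintype κ] : ι ⊕ κ → ℝ :=
  Sum.elim (fun _ => (Fintype.card ι : ℝ)⁻¹) (fun _ => -(Fintype.card κ : ℝ)⁻¹)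

theorem meanDiff_eq {ι κ : Type} [Fintype ι] [Fintype κ] (z : ι ⊕ κ → ℝ) :
    meanDiff z = ∑ x, meanDiffCoeff ι κ x * z x := by
  simp only [meanDiff, avg, Fintype.sum_sum_type, meanDiffCoeff, Sum.elim_inl, Sum.elim_inr,
    ← Finset.mul_sum]
  ring

/-- Second moment of a contrast of a randomly permuted array. -/
theorem sum_perm_sq_le {I : Type} [Fintype I] [DecidableEq I] (c z : I → ℝ) (hc : ∑ x, c x = 0)
    (hz0 : ∀ x, 0 ≤ z x) (hz1 : ∀ x, z x ≤ 1) :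
    ∑ σ : Equiv.Perm I, (∑ x, c x * z (σ x)) ^ 2 ≤
      Fintype.card (Equiv.Perm I) * ∑ x, c x ^ 2 := by
  -- By exchangeability `M` takes one value `A` on the diagonal and one value `B` off it. The
  -- constant part `B` is killed by `∑ x, c x = 0`, leaving `(A - B) * ∑ x, c x ^ 2`.
  let M : I → I → ℝ := fun x y => ∑ σ : Equiv.Perm I, z (σ x) * z (σ y)
  have hM : ∀ (π : Equiv.Perm I) x y, M (π x) (π y) = M x y := fun π x y =>
    Equiv.sum_comp (Equiv.mulRight π) fun σ : Equiv.Perm I => z (σ x) * z (σ y)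
  obtain ⟨A, hA⟩ : ∃ A, ∀ x, M x x = A := by
    by_cases h : Nonempty I
    · obtain ⟨x₀⟩ := h
      refine ⟨M x₀ x₀, fun x => ?_⟩
      rw [← hM (Equiv.swap x x₀) x x, Equiv.swap_apply_left]
    · exact ⟨0, fun x => (h ⟨x⟩).elim⟩
  obtain ⟨B, hB0, hB⟩ : ∃ B, 0 ≤ B ∧ ∀ x y, x ≠ y → M x y = B := by
    by_cases h : ∃ x₀ y₀ : I, x₀ ≠ y₀
    · obtain ⟨x₀, y₀, h0⟩ := h
      refine ⟨M x₀ y₀, Finset.sum_nonneg fun σ _ => mul_nonneg (hz0 _) (hz0 _),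
        fun x y hxy => ?_⟩
      have inj : ∀ a b : I, a ≠ b → Function.Injective fun k : Bool => if k then a else b :=
        fun a b hab k l hkl => by
          cases k <;> cases l <;> simp_all [eq_comm]
      obtain ⟨π, hπ⟩ := exists_perm_comp (inj _ _ h0) (inj _ _ hxy)
      have h1 := hπ true
      have h2 := hπ false
      simp only [if_true, Bool.false_eq_true, if_false] at h1 h2
      rw [← h1, ← h2, hM]
    · push Not at h
      exact ⟨0, le_rfl, fun x y hxy => (hxy (h x y)).elim⟩
  have hsq : ∑ σ : Equiv.Perm I, (∑ x, c x * z (σ x)) ^ 2 = ∑ x, ∑ y, c x * c y * M x y := by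
    simp only [sq, Finset.sum_mul_sum]
    simp only [M, Finset.mul_sum]
    rw [Finset.sum_comm]
    refine Finset.sum_congr rfl fun x _ => ?_
    rw [Finset.sum_comm]
    refine Finset.sum_congr rfl fun y _ => Finset.sum_congr rfl fun σ _ => ?_
    ring
  have hM' : ∀ x y, c x * c y * M x y = B * (c x * c y) + if x = y then (A - B) * c x ^ 2 else 0 :=
    fun x y => by
      split_ifs with h
      · rw [← h, hA]
        ring
      · rw [hB x y h]
        ring
  have hval : ∑ x, ∑ y, c x * c y * M x y = (A - B) * ∑ x, c x ^ 2 := by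
    simp only [hM', Finset.sum_add_distrib, ← Finset.mul_sum, hc, Finset.sum_ite_eq,
      Finset.mem_univ, if_true]
    simp
  rw [hsq, hval]
  by_cases h : Nonempty I
  · obtain ⟨x₀⟩ := h
    have hA1 : A ≤ Fintype.card (Equiv.Perm I) := by
      rw [← hA x₀]
      calc M x₀ x₀ ≤ ∑ _σ : Equiv.Perm I, (1 : ℝ) :=
            Finset.sum_le_sum fun σ _ => mul_le_one₀ (hz1 _) (hz0 _) (hz1 _)
        _ = _ := by simp
    refine mul_le_mul_of_nonneg_right (by linarith) (Finset.sum_nonneg fun x _ => sq_nonneg _)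
  · have := not_nonempty_iff.1 h
    simp

/-- Chebyshev bound for the p-value of the permutation test. -/
theorem permPValue_le {ι κ : Type} [Fintype ι] [Fintype κ] [Nonempty ι] [Nonempty κ]
    (u : ι → ℝ) (v : κ → ℝ) (hu : ∀ i, 0 ≤ u i ∧ u i ≤ 1) (hv : ∀ i, 0 ≤ v i ∧ v i ≤ 1)
    {c : ℝ} (hc : 0 < c) (h : c ≤ |avg u - avg v|) :
    permPValue u v ≤ ((Fintype.card ι : ℝ)⁻¹ + (Fintype.card κ : ℝ)⁻¹) / c ^ 2 := by
  classical
  have hι : (Fintype.card ι : ℝ) ≠ 0 := by simp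
  have hκ : (Fintype.card κ : ℝ) ≠ 0 := by simp
  have h1 : ∑ x, meanDiffCoeff ι κ x = 0 := by
    simp [meanDiffCoeff, hι, hκ]
  have h2 : ∑ x, meanDiffCoeff ι κ x ^ 2 =
      (Fintype.card ι : ℝ)⁻¹ + (Fintype.card κ : ℝ)⁻¹ := by
    simp only [meanDiffCoeff, Fintype.sum_sum_type, Sum.elim_inl, Sum.elim_inr,
      Finset.sum_const, Finset.card_univ, nsmul_eq_mul]
    field_simp
  have h3 := sum_perm_sq_le _ (Sum.elim u v) h1
    (fun x => by cases x <;> simp [hu, hv]) (fun x => by cases x <;> simp [hu, hv])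
  rw [h2] at h3
  have hm : c ≤ |meanDiff (Sum.elim u v)| := h
  have hN : (0 : ℝ) < Fintype.card (Equiv.Perm (ι ⊕ κ)) := by exact_mod_cast Fintype.card_pos
  rw [permPValue, div_le_div_iff₀ hN (by positivity)]
  refine le_trans ?_ ((h3.trans_eq (mul_comm _ _)))
  calc _ = ∑ σ : Equiv.Perm (ι ⊕ κ), if |meanDiff (Sum.elim u v)| ≤
        |meanDiff (fun x => Sum.elim u v (σ x))| then c ^ 2 else 0 := by
        rw [← Finset.sum_filter, Finset.sum_const, nsmul_eq_mul]
    _ ≤ _ := Finset.sum_le_sum fun σ _ => by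
        rw [← meanDiff_eq fun x => Sum.elim u v (σ x)]
        split_ifs with hσ
        · rw [← sq_abs (meanDiff _)]
          exact pow_le_pow_left₀ hc.le (hm.trans hσ) 2
        · positivity

/-! ## Hoeffding's inequality for random signs -/

-- Chernoff's method applied to both tails, each sign contributing `cosh y ≤ exp (y ^ 2 / 2)` to the
-- moment generating function.
open Classical in
theorem sign_sum_tail {κ : Type} [Fintype κ] (b : κ → ℝ) {v α : ℝ} (hv : 0 < v)
    (hb : ∑ k, b k ^ 2 ≤ v) (hα₀ : 0 < α) (hα₁ : α < 1) :
    ∑ s : κ → Bool, (∏ _k : κ, (1 / 2 : ℝ)) *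
      (if Real.sqrt (2 * v * Real.log (2 / α)) < |∑ k, (if s k then -1 else 1) * b k|
        then 1 else 0) ≤ α := by
  set L := Real.log (2 / α)
  have hL : 0 < L := Real.log_pos (by rw [lt_div_iff₀ hα₀]; linarith)
  set T := Real.sqrt (2 * v * L)
  have hT : T ^ 2 = 2 * v * L := Real.sq_sqrt (by positivity)
  -- The optimal tilt: `θ ^ 2 * v / 2 = L` and `θ * T = 2 * L`, so the two tails add up to `2 * exp
  -- (-L) = α`.
  set θ := T / v
  have hmgf : ∀ η : ℝ, η ^ 2 = θ ^ 2 → ∑ s : κ → Bool, (∏ _k : κ, (1 / 2 : ℝ)) *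
      Real.exp (η * ∑ k, (if s k then -1 else 1) * b k) ≤ Real.exp L := fun η hη => by
    have h1 := sum_prod_mul_prod_comp (ι := κ) Function.injective_id
      (fun (_ : κ) (_ : Bool) => (1 / 2 : ℝ)) (fun _ => by norm_num [Fintype.sum_bool])
      fun k s => Real.exp (η * ((if s then -1 else 1) * b k))
    simp only [id, ← Real.exp_sum, ← Finset.mul_sum] at h1
    rw [← Finset.mul_sum, h1]
    have h2 : ∀ k, (1 / 2 : ℝ) * ∑ s : Bool, Real.exp (η * ((if s then -1 else 1) * b k)) ≤
        Real.exp (θ ^ 2 / 2 * b k ^ 2) := fun k => by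
      have := Real.cosh_le_exp_half_sq (η * b k)
      rw [Real.cosh_eq, mul_pow, hη] at this
      refine le_trans (le_of_eq ?_) (this.trans_eq ?_)
      · simp only [Fintype.sum_bool, if_true, Bool.false_eq_true, if_false]
        ring_nf
      · ring_nf
    refine (Finset.prod_le_prod (fun k _ => by positivity) fun k _ => h2 k).trans ?_
    rw [← Real.exp_sum, ← Finset.mul_sum, Real.exp_le_exp]
    have : θ ^ 2 / 2 * v = L := by
      simp only [θ, div_pow, hT]
      field_simp
    rw [← this]
    exact mul_le_mul_of_nonneg_left hb (by positivity)
  have hθT : θ * T = 2 * L := by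
    simp only [θ]
    rw [div_mul_eq_mul_div, ← sq, hT]
    field_simp
  have hθ : 0 ≤ θ := by positivity
  have hind : ∀ γ : ℝ, (if T < |γ| then (1 : ℝ) else 0) ≤
      Real.exp (-(2 * L)) * (Real.exp (θ * γ) + Real.exp (-θ * γ)) := fun γ => by
    split_ifs with hlt
    · rw [mul_add, ← Real.exp_add, ← Real.exp_add]
      rcases le_abs.1 hlt.le with h | h
      · have := Real.one_le_exp (x := -(2 * L) + θ * γ) (by nlinarith)
        linarith [Real.exp_pos (-(2 * L) + -θ * γ)]
      · have := Real.one_le_exp (x := -(2 * L) + -θ * γ) (by nlinarith)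
        linarith [Real.exp_pos (-(2 * L) + θ * γ)]
    · positivity
  calc _ ≤ ∑ s : κ → Bool, (∏ _k : κ, (1 / 2 : ℝ)) * (Real.exp (-(2 * L)) *
        (Real.exp (θ * ∑ k, (if s k then -1 else 1) * b k) +
          Real.exp (-θ * ∑ k, (if s k then -1 else 1) * b k))) :=
        Finset.sum_le_sum fun s _ => mul_le_mul_of_nonneg_left (hind _) (by positivity)
    _ = Real.exp (-(2 * L)) * (∑ s : κ → Bool, (∏ _k : κ, (1 / 2 : ℝ)) *
          Real.exp (θ * ∑ k, (if s k then -1 else 1) * b k) + ∑ s : κ → Bool,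
          (∏ _k : κ, (1 / 2 : ℝ)) * Real.exp (-θ * ∑ k, (if s k then -1 else 1) * b k)) := by
        rw [← Finset.sum_add_distrib, Finset.mul_sum]
        exact Finset.sum_congr rfl fun s _ => by ring
    _ ≤ Real.exp (-(2 * L)) * (Real.exp L + Real.exp L) :=
        mul_le_mul_of_nonneg_left (add_le_add (hmgf θ rfl) (hmgf (-θ) (by ring)))
          (Real.exp_pos _).le
    _ = α := by
        rw [← two_mul, mul_left_comm, ← Real.exp_add]
        have : -(2 * L) + L = -L := by ring
        rw [this, Real.exp_neg, Real.exp_log (by positivity)]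
        field_simp

/-! ## Properties of the two tests -/

/-- Exchange the two decisions of a tuple if `b` holds. -/
def swapAt {n : ℕ} (b : Bool) (t : ReviewTuple n) : ReviewTuple n :=
  if b then ⟨t.paper, t.X, t.Y, t.w⟩ else t

@[simp] theorem swapAt_w {n : ℕ} (b : Bool) (t : ReviewTuple n) : (swapAt b t).w = t.w := by
  cases b <;> rfl

/-- The outcome of the test depends on the tuples only up to the labelling of the family. -/
def IsReindexInvariant (test : StatTest) : Prop :=
  ∀ (n : ℕ) (κ κ' : Type) [Fintype κ] [Fintype κ'] (e : κ ≃ κ') (t : κ' → ReviewTuple n),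
    test n κ (fun k => t (e k)) ↔ test n κ' t

open Classical in
/-- The test has level `α` if the two decisions of each tuple are exchanged at random. -/
def HasSwapLevel (α : ℝ) (test : StatTest) : Prop :=
  ∀ (n : ℕ) (κ : Type) [Fintype κ] (t : κ → ReviewTuple n),
    ∑ s : κ → Bool, (∏ _k : κ, (1 / 2 : ℝ)) *
      (if test n κ (fun k => swapAt (s k) (t k)) then 1 else 0) ≤ α

/-- The test rejects large families of tuples with a clear bias. -/
def RejectsBias (test : StatTest) : Prop :=
  ∀ d : ℝ, 0 < d → ∃ K : ℕ, ∀ (n : ℕ) (κ : Type) [Fintype κ] (t : κ → ReviewTuple n),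
    K ≤ (Finset.univ.filter fun k => (t k).w = 1).card →
    K ≤ (Finset.univ.filter fun k => (t k).w = -1).card →
    d / 2 * (Finset.univ.filter fun k => (t k).w = 1).card ≤
      ∑ k with (t k).w = 1, (dec (t k).Y - dec (t k).X) →
    d / 2 * (Finset.univ.filter fun k => (t k).w = -1).card ≤
      ∑ k with (t k).w = -1, (dec (t k).X - dec (t k).Y) → test n κ t

/-- The arrays are indexed by subtypes that depend on the tuples. Transporting them to arbitrary
equivalent types allows the tests of different families to be compared on common index types. -/
theorem disagreementTest_iff {α : ℝ} {n : ℕ} {κ A B : Type} [Fintype κ] [Fintype A] [Fintype B]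
    (t : κ → ReviewTuple n) (eA : A ≃ {k : κ // (t k).Y ≠ (t k).X ∧ (t k).w = 1})
    (eB : B ≃ {k : κ // (t k).Y ≠ (t k).X ∧ (t k).w = -1}) :
    disagreementTest α n κ t ↔ Nonempty A ∧ Nonempty B ∧
      permPValue (fun a => dec (t (eA a)).Y) (fun b => dec (t (eB b)).Y) ≤ α := by
  unfold disagreementTest
  dsimp only
  rw [eA.nonempty_congr, eB.nonempty_congr, nonempty_subtype, nonempty_subtype,
    ← permPValue_comp eA eB]

theorem countingTest_iff {α : ℝ} {n : ℕ} {κ A B : Type} [Fintype κ] [Fintype A] [Fintype B]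
    (t : κ → ReviewTuple n) (eA : A ≃ {k : κ // (t k).w = 1})
    (eB : B ≃ {k : κ // (t k).w = -1}) :
    countingTest α n κ t ↔ Nonempty A ∧ Nonempty B ∧
      Real.sqrt (2 * ((Fintype.card A : ℝ)⁻¹ + (Fintype.card B : ℝ)⁻¹) * Real.log (2 / α)) <
        |avg (fun a => dec (t (eA a)).Y - dec (t (eA a)).X) -
          avg (fun b => dec (t (eB b)).Y - dec (t (eB b)).X)| := by
  classical
  unfold countingTest
  dsimp only
  rw [eA.nonempty_congr, eB.nonempty_congr, nonempty_subtype, nonempty_subtype,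
    ← avg_comp eA, ← avg_comp eB, Fintype.card_congr eA, Fintype.card_congr eB]

theorem disagreementTest_reindex (α : ℝ) : IsReindexInvariant (disagreementTest α) := by
  classical
  intro n κ κ' _ _ e t
  rw [disagreementTest_iff (fun k => t (e k)) (Equiv.refl _) (Equiv.refl _),
    disagreementTest_iff t (e.subtypeEquiv fun _ => Iff.rfl) (e.subtypeEquiv fun _ => Iff.rfl)]
  rfl

theorem countingTest_reindex (α : ℝ) : IsReindexInvariant (countingTest α) := by
  classical
  intro n κ κ' _ _ e t
  rw [countingTest_iff (fun k => t (e k)) (Equiv.refl _) (Equiv.refl _),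
    countingTest_iff t (e.subtypeEquiv fun _ => Iff.rfl) (e.subtypeEquiv fun _ => Iff.rfl)]
  rfl

/-! ### Level of the two tests under random swaps. -/

theorem disagreementTest_swapLevel {α : ℝ} (hα : 0 ≤ α) :
    HasSwapLevel α (disagreementTest α) := by
  classical
  intro n κ _ t
  let A := {k : κ // (t k).Y ≠ (t k).X ∧ (t k).w = 1}
  let B := {k : κ // (t k).Y ≠ (t k).X ∧ (t k).w = -1}
  -- A swap preserves disagreement, so the index types `A` and `B` of the arrays do not depend on
  -- `s`.
  have hne : ∀ (s : κ → Bool) k, (swapAt (s k) (t k)).Y ≠ (swapAt (s k) (t k)).X ↔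
      (t k).Y ≠ (t k).X := fun s k => by
    cases h : s k <;> simp [swapAt, ne_comm]
  have hiff : ∀ s : κ → Bool, disagreementTest α n κ (fun k => swapAt (s k) (t k)) ↔
      Nonempty A ∧ Nonempty B ∧ permPValue (fun a : A => dec (swapAt (s a) (t a)).Y)
        (fun b : B => dec (swapAt (s b) (t b)).Y) ≤ α := fun s =>
    disagreementTest_iff _ (A := A) (B := B)
      (Equiv.subtypeEquivRight fun k => by rw [hne, swapAt_w])
      (Equiv.subtypeEquivRight fun k => by rw [hne, swapAt_w])
  simp only [hiff]
  by_cases hAB : Nonempty A ∧ Nonempty B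
  · simp only [hAB.1, hAB.2, true_and]
    let r : A ⊕ B → κ := Sum.elim Subtype.val Subtype.val
    have hr : Function.Injective r := by
      refine Subtype.val_injective.sumElim Subtype.val_injective fun a b hab => ?_
      have h1 := a.2.2
      rw [hab, b.2.2] at h1
      norm_num at h1
    have hrne : ∀ x, (t (r x)).Y ≠ (t (r x)).X := by
      rintro (a | b)
      exacts [a.2.1, b.2.1]
    have := sum_prod_mul_comp hr (fun (_ : κ) (_ : Bool) => (1 / 2 : ℝ))
      (fun _ => by norm_num [Fintype.sum_bool]) (fun x b => (swapAt b (t (r x))).Y)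
      (fun z => if permPValue (fun i => dec (z (Sum.inl i))) (fun k => dec (z (Sum.inr k))) ≤ α
        then (1 : ℝ) else 0)
    refine (this.trans ?_).trans_le (permPValue_level (ι := A) (κ := B) hα)
    refine Finset.sum_congr (by ext; simp) fun z _ => ?_
    congr 1
    refine Finset.prod_congr rfl fun x _ => ?_
    have hx := hrne x
    revert hx
    generalize t (r x) = q
    obtain ⟨p, Y, X, w⟩ := q
    -- As `Y ≠ X`, exactly one of the two coin values produces `z x`, so each factor is `1 / 2`.
    cases Y <;> cases X <;> cases z x <;> simp [swapAt]
  · have : ∀ s : κ → Bool, ¬ (Nonempty A ∧ Nonempty B ∧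
        permPValue (fun a : A => dec (swapAt (s a) (t a)).Y)
        (fun b : B => dec (swapAt (s b) (t b)).Y) ≤ α) := fun s h => hAB ⟨h.1, h.2.1⟩
    simp [this, hα]

theorem avg_subtype {κ : Type} [Fintype κ] (p : κ → Prop) [DecidablePred p] (f : κ → ℝ) :
    avg (fun k : {k // p k} => f k) =
      ∑ k, if p k then (Fintype.card {k // p k} : ℝ)⁻¹ * f k else 0 := by
  rw [avg, ← Finset.sum_filter, ← Finset.mul_sum, div_eq_inv_mul,
    Finset.sum_subtype (p := p) (Finset.univ.filter p) (by simp)]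

theorem abs_dec_sub_le (a b : Bool) : |dec a - dec b| ≤ 1 := by
  cases a <;> cases b <;> simp [dec]

theorem countingTest_swapLevel {α : ℝ} (hα₀ : 0 < α) (hα₁ : α < 1) :
    HasSwapLevel α (countingTest α) := by
  classical
  intro n κ _ t
  let A := {k : κ // (t k).w = 1}
  let B := {k : κ // (t k).w = -1}
  -- A swap negates `Y - X`, so the statistic is a sum of the `b k` with random signs. As `|Y - X| ≤
  -- 1`, the squares sum to at most `|A|⁻¹ + |B|⁻¹`, the variance proxy in the threshold.
  let b : κ → ℝ := fun k => (if (t k).w = 1 then (Fintype.card A : ℝ)⁻¹ else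
    if (t k).w = -1 then -(Fintype.card B : ℝ)⁻¹ else 0) * (dec (t k).Y - dec (t k).X)
  have hdec : ∀ (s : κ → Bool) k, dec (swapAt (s k) (t k)).Y - dec (swapAt (s k) (t k)).X =
      (if s k then -1 else 1) * (dec (t k).Y - dec (t k).X) := fun s k => by
    cases s k <;> simp [swapAt]
  have hiff : ∀ s : κ → Bool, countingTest α n κ (fun k => swapAt (s k) (t k)) ↔
      Nonempty A ∧ Nonempty B ∧
      Real.sqrt (2 * ((Fintype.card A : ℝ)⁻¹ + (Fintype.card B : ℝ)⁻¹) * Real.log (2 / α)) <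
        |∑ k, (if s k then -1 else 1) * b k| := fun s => by
    rw [countingTest_iff _ (A := A) (B := B)
      (Equiv.subtypeEquivRight fun k => by rw [swapAt_w])
      (Equiv.subtypeEquivRight fun k => by rw [swapAt_w])]
    simp only [hdec]
    change _ ∧ _ ∧ _ < |avg (fun k : {k // (t k).w = 1} =>
        (if s k then (-1 : ℝ) else 1) * (dec (t k).Y - dec (t k).X)) -
      avg (fun k : {k // (t k).w = -1} =>
        (if s k then (-1 : ℝ) else 1) * (dec (t k).Y - dec (t k).X))| ↔ _
    rw [avg_subtype (fun k => (t k).w = 1) fun k =>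
      (if s k then -1 else 1) * (dec (t k).Y - dec (t k).X),
      avg_subtype (fun k => (t k).w = -1) fun k =>
      (if s k then -1 else 1) * (dec (t k).Y - dec (t k).X), ← Finset.sum_sub_distrib]
    have : ∀ k, ((if (t k).w = 1 then (Fintype.card A : ℝ)⁻¹ *
        ((if s k then -1 else 1) * (dec (t k).Y - dec (t k).X)) else 0) -
        if (t k).w = -1 then (Fintype.card B : ℝ)⁻¹ *
        ((if s k then -1 else 1) * (dec (t k).Y - dec (t k).X)) else 0) =
        (if s k then -1 else 1) * b k := fun k => by
      simp only [b]
      by_cases h1 : (t k).w = 1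
      · have h2 : (t k).w ≠ -1 := by rw [h1]; norm_num
        rw [if_pos h1, if_pos h1, if_neg h2]
        ring
      · by_cases h2 : (t k).w = -1
        · rw [if_neg h1, if_neg h1, if_pos h2, if_pos h2]
          ring
        · rw [if_neg h1, if_neg h1, if_neg h2, if_neg h2]
          ring
    rw [Finset.sum_congr rfl fun k _ => this k]
  simp only [hiff]
  by_cases hAB : Nonempty A ∧ Nonempty B
  · obtain ⟨hA, hB⟩ := hAB
    simp only [hA, hB, true_and]
    have hA' : (0 : ℝ) < Fintype.card A := by exact_mod_cast Fintype.card_pos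
    have hB' : (0 : ℝ) < Fintype.card B := by exact_mod_cast Fintype.card_pos
    have hcA : Fintype.card A = (Finset.univ.filter fun k => (t k).w = 1).card :=
      Fintype.card_subtype _
    have hcB : Fintype.card B = (Finset.univ.filter fun k => (t k).w = -1).card :=
      Fintype.card_subtype _
    refine sign_sum_tail b (by positivity) ?_ hα₀ hα₁
    have hb : ∀ k, b k ^ 2 ≤ (if (t k).w = 1 then (Fintype.card A : ℝ)⁻¹ ^ 2 else 0) +
        if (t k).w = -1 then (Fintype.card B : ℝ)⁻¹ ^ 2 else 0 := fun k => by
      have h0 : (dec (t k).Y - dec (t k).X) ^ 2 ≤ 1 := by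
        rw [← sq_abs]
        exact pow_le_one₀ (abs_nonneg _) (abs_dec_sub_le _ _)
      simp only [b]
      by_cases h1 : (t k).w = 1
      · have h2 : (t k).w ≠ -1 := by rw [h1]; norm_num
        rw [if_pos h1, if_pos h1, if_neg h2, mul_pow, add_zero]
        exact mul_le_of_le_one_right (by positivity) h0
      · by_cases h2 : (t k).w = -1
        · rw [if_neg h1, if_neg h1, if_pos h2, if_pos h2, mul_pow, zero_add, neg_sq]
          exact mul_le_of_le_one_right (by positivity) h0
        · rw [if_neg h1, if_neg h1, if_neg h2, if_neg h2]
          simp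
    refine (Finset.sum_le_sum fun k _ => hb k).trans (le_of_eq ?_)
    rw [Finset.sum_add_distrib, ← Finset.sum_filter, ← Finset.sum_filter, Finset.sum_const,
      Finset.sum_const, ← hcA, ← hcB, nsmul_eq_mul, nsmul_eq_mul]
    field_simp
  · have : ∀ s : κ → Bool, ¬ (Nonempty A ∧ Nonempty B ∧
        Real.sqrt (2 * ((Fintype.card A : ℝ)⁻¹ + (Fintype.card B : ℝ)⁻¹) * Real.log (2 / α)) <
        |∑ k, (if s k then -1 else 1) * b k|) := fun s h => hAB ⟨h.1, h.2.1⟩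
    simp only [this, if_false, mul_zero, Finset.sum_const_zero]
    exact hα₀.le

/-! ### Rejection of clear bias in large families. -/

theorem countingTest_rejectsBias {α : ℝ} (hα₀ : 0 < α) (hα₁ : α < 1) :
    RejectsBias (countingTest α) := by
  classical
  intro d hd
  have hL : 0 < Real.log (2 / α) := Real.log_pos (by rw [lt_div_iff₀ hα₀]; linarith)
  -- The two means lie on opposite sides of zero at distance at least `d / 2`, so their difference
  -- is at least `d`, while the squared threshold is at most `4 * log (2 / α) / K`.
  obtain ⟨K, hK⟩ := exists_nat_gt (4 * Real.log (2 / α) / d ^ 2)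
  have hK0 : (0 : ℝ) < K := lt_of_le_of_lt (by positivity) hK
  refine ⟨K, fun n κ _ t hU hV hsU hsV => ?_⟩
  rw [countingTest_iff t (Equiv.refl _) (Equiv.refl _)]
  simp only [Equiv.refl_apply, avg]
  rw [← Finset.sum_subtype (Finset.univ.filter fun k => (t k).w = 1) (by simp)
      fun k => dec (t k).Y - dec (t k).X,
    ← Finset.sum_subtype (Finset.univ.filter fun k => (t k).w = -1) (by simp)
      fun k => dec (t k).Y - dec (t k).X, Fintype.card_subtype, Fintype.card_subtype,
    nonempty_subtype, nonempty_subtype]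
  set a := (Finset.univ.filter fun k => (t k).w = 1).card with ha
  set b := (Finset.univ.filter fun k => (t k).w = -1).card with hb
  have haK : (K : ℝ) ≤ a := by exact_mod_cast hU
  have hbK : (K : ℝ) ≤ b := by exact_mod_cast hV
  have ha0 : (0 : ℝ) < a := hK0.trans_le haK
  have hb0 : (0 : ℝ) < b := hK0.trans_le hbK
  have hex : ∀ w : ℤ, (0 : ℝ) < (Finset.univ.filter fun k => (t k).w = w).card →
      ∃ k, (t k).w = w := fun w hw => by
    obtain ⟨k, hk⟩ := Finset.card_pos.1 (Nat.cast_pos.1 hw)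
    exact ⟨k, (Finset.mem_filter.1 hk).2⟩
  refine ⟨hex 1 ha0, hex (-1) hb0, ?_⟩
  have h1 : d / 2 ≤ (∑ k with (t k).w = 1, (dec (t k).Y - dec (t k).X)) / a := by
    rwa [le_div_iff₀ ha0]
  have h2 : (∑ k with (t k).w = -1, (dec (t k).Y - dec (t k).X)) / b ≤ -(d / 2) := by
    rw [div_le_iff₀ hb0]
    have : ∑ k with (t k).w = -1, (dec (t k).X - dec (t k).Y) =
      -∑ k with (t k).w = -1, (dec (t k).Y - dec (t k).X) := by
      rw [← Finset.sum_neg_distrib]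
      simp
    linarith
  refine lt_of_lt_of_le ?_ (le_abs_self _)
  refine lt_of_lt_of_le (b := d) ?_ (by linarith)
  rw [Real.sqrt_lt' hd]
  have h3 : (a : ℝ)⁻¹ ≤ (K : ℝ)⁻¹ := inv_anti₀ hK0 haK
  have h4 : (b : ℝ)⁻¹ ≤ (K : ℝ)⁻¹ := inv_anti₀ hK0 hbK
  calc 2 * ((a : ℝ)⁻¹ + (b : ℝ)⁻¹) * Real.log (2 / α)
      ≤ 2 * ((K : ℝ)⁻¹ + (K : ℝ)⁻¹) * Real.log (2 / α) := by gcongr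
    _ = 4 * Real.log (2 / α) / K := by ring
    _ < d ^ 2 := by
      rw [div_lt_iff₀ (by positivity)] at hK
      rw [div_lt_iff₀ hK0]
      linarith

/-- If the decisions `f` exceed the decisions `g` by a margin, the same holds, even more clearly,
among the disagreements. -/
theorem avg_disagreements {κ : Type} [Fintype κ] (f g : κ → Bool) (P : κ → Prop)
    [DecidablePred P] {d : ℝ} (hd : 0 < d) (hP : 0 < (Finset.univ.filter P).card)
    (h : d / 2 * (Finset.univ.filter P).card ≤ ∑ k with P k, (dec (f k) - dec (g k))) :
    d / 2 * (Finset.univ.filter P).card ≤ Fintype.card {k // f k ≠ g k ∧ P k} ∧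
      1 / 2 + d / 4 ≤ avg (fun k : {k // f k ≠ g k ∧ P k} => dec (f k)) ∧
      avg (fun k : {k // f k ≠ g k ∧ P k} => dec (g k)) ≤ 1 / 2 - d / 4 := by
  -- Agreements contribute zero, so the same sum is spread over fewer entries and its mean can only
  -- grow.
  have hs : ∑ k with P k, (dec (f k) - dec (g k)) =
      ∑ k with f k ≠ g k ∧ P k, (dec (f k) - dec (g k)) := by
    rw [Finset.sum_filter, Finset.sum_filter]
    refine Finset.sum_congr rfl fun k _ => ?_
    by_cases h1 : f k = g k <;> simp [h1]
  rw [hs] at h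
  have hc : Fintype.card {k // f k ≠ g k ∧ P k} =
    (Finset.univ.filter fun k => f k ≠ g k ∧ P k).card := Fintype.card_subtype _
  have hle : (Finset.univ.filter fun k => f k ≠ g k ∧ P k).card ≤ (Finset.univ.filter P).card :=
    Finset.card_le_card fun k hk => by
      rw [Finset.mem_filter] at hk ⊢
      exact ⟨hk.1, hk.2.2⟩
  have hP' : (0 : ℝ) < (Finset.univ.filter P).card := by exact_mod_cast hP
  have hle' : ((Finset.univ.filter fun k => f k ≠ g k ∧ P k).card : ℝ) ≤
    (Finset.univ.filter P).card := by exact_mod_cast hle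
  have hsum : ∑ k with f k ≠ g k ∧ P k, (dec (f k) - dec (g k)) ≤
      (Finset.univ.filter fun k => f k ≠ g k ∧ P k).card := by
    refine (Finset.sum_le_card_nsmul _ _ 1 fun k _ => (abs_le.1 (abs_dec_sub_le _ _)).2).trans ?_
    simp
  have hpos : (0 : ℝ) < (Finset.univ.filter fun k => f k ≠ g k ∧ P k).card :=
    lt_of_lt_of_le (by positivity) (h.trans hsum)
  -- At a disagreement the two decisions add up to one, so each is determined by their difference.
  have hpair : ∀ k ∈ Finset.univ.filter (fun k => f k ≠ g k ∧ P k),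
      dec (f k) = 1 / 2 + (dec (f k) - dec (g k)) / 2 ∧
      dec (g k) = 1 / 2 - (dec (f k) - dec (g k)) / 2 := fun k hk => by
    have := (Finset.mem_filter.1 hk).2.1
    revert this
    cases f k <;> cases g k <;> norm_num [dec]
  rw [hc]
  refine ⟨h.trans hsum, ?_, ?_⟩
  · rw [avg, hc, ← Finset.sum_subtype (Finset.univ.filter fun k => f k ≠ g k ∧ P k) (by simp)
      fun k => dec (f k), le_div_iff₀ hpos, Finset.sum_congr rfl fun k hk => (hpair k hk).1,
      Finset.sum_add_distrib, Finset.sum_const, ← Finset.sum_div, nsmul_eq_mul]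
    nlinarith
  · rw [avg, hc, ← Finset.sum_subtype (Finset.univ.filter fun k => f k ≠ g k ∧ P k) (by simp)
      fun k => dec (g k), div_le_iff₀ hpos, Finset.sum_congr rfl fun k hk => (hpair k hk).2,
      Finset.sum_sub_distrib, Finset.sum_const, ← Finset.sum_div, nsmul_eq_mul]
    nlinarith

theorem disagreementTest_rejectsBias {α : ℝ} (hα₀ : 0 < α) :
    RejectsBias (disagreementTest α) := by
  classical
  intro d hd
  -- Each array has at least `d / 2 * K` disagreements and the means differ by at least `d / 2`, so
  -- `permPValue_le` bounds the p-value by `16 / (d ^ 3 * K)`.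
  obtain ⟨K, hK⟩ := exists_nat_gt (16 / (d ^ 3 * α))
  have hK0 : (0 : ℝ) < K := lt_of_le_of_lt (by positivity) hK
  refine ⟨K, fun n κ _ t hU hV hsU hsV => ?_⟩
  have hK0' : 0 < K := by exact_mod_cast hK0
  obtain ⟨hA1, hA2, -⟩ := avg_disagreements (fun k => (t k).Y) (fun k => (t k).X)
    (fun k => (t k).w = 1) hd (hK0'.trans_le hU) hsU
  -- For weight `-1` the DB decisions are the larger ones, so the roles of `Y` and `X` are
  -- exchanged.
  obtain ⟨hB1, -, hB2⟩ := avg_disagreements (fun k => (t k).X) (fun k => (t k).Y)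
    (fun k => (t k).w = -1) hd (hK0'.trans_le hV) hsV
  rw [disagreementTest_iff t (Equiv.refl _) (Equiv.subtypeEquivRight fun k => by
    rw [ne_comm (a := (t k).X)] : {k : κ // (t k).X ≠ (t k).Y ∧ (t k).w = -1} ≃ _)]
  simp only [Equiv.refl_apply, Equiv.subtypeEquivRight_apply_coe]
  have hU' : (K : ℝ) ≤ (Finset.univ.filter fun k => (t k).w = 1).card := by exact_mod_cast hU
  have hV' : (K : ℝ) ≤ (Finset.univ.filter fun k => (t k).w = -1).card := by exact_mod_cast hV
  have hA3 : d / 2 * K ≤ Fintype.card {k : κ // (t k).Y ≠ (t k).X ∧ (t k).w = 1} :=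
    le_trans (by gcongr) hA1
  have hB3 : d / 2 * K ≤ Fintype.card {k : κ // (t k).X ≠ (t k).Y ∧ (t k).w = -1} :=
    le_trans (by gcongr) hB1
  have hdK : 0 < d / 2 * K := by positivity
  have hA : Nonempty {k : κ // (t k).Y ≠ (t k).X ∧ (t k).w = 1} :=
    Fintype.card_pos_iff.1 (Nat.cast_pos.1 (hdK.trans_le hA3))
  have hB : Nonempty {k : κ // (t k).X ≠ (t k).Y ∧ (t k).w = -1} :=
    Fintype.card_pos_iff.1 (Nat.cast_pos.1 (hdK.trans_le hB3))
  have hdec : ∀ b : Bool, 0 ≤ dec b ∧ dec b ≤ 1 := fun b => by cases b <;> simp [dec]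
  refine ⟨hA, hB, (permPValue_le _ _ (fun _ => hdec _) (fun _ => hdec _) (half_pos hd)
    (le_trans (by linarith) (le_abs_self _))).trans ?_⟩
  have h3 := inv_anti₀ hdK hA3
  have h4 := inv_anti₀ hdK hB3
  rw [div_le_iff₀ (by positivity)]
  refine (add_le_add h3 h4).trans ?_
  rw [div_lt_iff₀ (by positivity)] at hK
  have : (d / 2 * K)⁻¹ + (d / 2 * K)⁻¹ = 4 / (d * K) := by
    field_simp
    norm_num
  rw [this, div_le_iff₀ (by positivity)]
  nlinarith

/-! ## Relabelling the reviewers -/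

/-! ### Images of uniform laws and of composite experiments under bijections. -/

theorem map_equiv_apply {α β : Type} (p : PMF α) (e : α ≃ β) (a : α) : (p.map e) (e a) = p a := by
  classical
  rw [PMF.map_apply]
  simp only [e.injective.eq_iff]
  rw [tsum_eq_single a (fun b hb => if_neg hb.symm), if_pos rfl]

/-- This reduces equivariance of a multistage experiment to equivariance of each stage. -/
theorem map_bind_of {α α' β β' : Type} {p : PMF α} {q : α → PMF β} {p' : PMF α'}
    {q' : α' → PMF β'} (e : α → α') (f : β → β') (hp : p.map e = p')
    (hq : ∀ a, (q a).map f = q' (e a)) : (p.bind q).map f = p'.bind q' := by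
  rw [PMF.map_bind, ← hp, PMF.bind_map]
  congr 1
  exact funext hq

theorem uniformOfFinset_map {β : Type} {s s' : Finset β} (hs : s.Nonempty) (hs' : s'.Nonempty)
    (e : β ≃ β) (h : ∀ x, e x ∈ s' ↔ x ∈ s) :
    (PMF.uniformOfFinset s hs).map e = PMF.uniformOfFinset s' hs' := by
  ext b
  obtain ⟨x, rfl⟩ := e.surjective b
  have hc : s.card = s'.card := Finset.card_equiv e fun x => (h x).symm
  rw [map_equiv_apply, PMF.uniformOfFinset_apply, PMF.uniformOfFinset_apply, hc]
  by_cases hx : x ∈ s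
  · rw [if_pos hx, if_pos ((h x).2 hx)]
  · rw [if_neg hx, if_neg fun h' => hx ((h x).1 h')]

theorem nonempty_iff_of_equiv {β : Type} {s s' : Finset β} (e : β ≃ β)
    (h : ∀ x, e x ∈ s' ↔ x ∈ s) : s'.Nonempty ↔ s.Nonempty := by
  constructor
  · rintro ⟨y, hy⟩
    exact ⟨e.symm y, by rwa [← h, e.apply_symm_apply]⟩
  · rintro ⟨x, hx⟩
    exact ⟨e x, (h x).2 hx⟩

/-- Fixing `default` matters when `s` is empty, as the law is then the point mass there. -/
theorem uniformOn_map {β : Type} [Inhabited β] {s s' : Finset β} (e : β ≃ β)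
    (he : e default = default) (h : ∀ x, e x ∈ s' ↔ x ∈ s) :
    (uniformOn s).map e = uniformOn s' := by
  have hne := nonempty_iff_of_equiv e h
  unfold uniformOn
  by_cases hs : s.Nonempty
  · rw [dif_pos hs, dif_pos (hne.2 hs), uniformOfFinset_map hs (hne.2 hs) e h]
  · rw [dif_neg hs, dif_neg fun h' => hs (hne.1 h'), PMF.pure_map, he]

theorem uniformOption_map {β : Type} {s s' : Finset β} (e : β ≃ β)
    (h : ∀ x, e x ∈ s' ↔ x ∈ s) : (uniformOption s).map (Option.map e) = uniformOption s' := by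
  have hne := nonempty_iff_of_equiv e h
  unfold uniformOption
  by_cases hs : s.Nonempty
  · rw [dif_pos hs, dif_pos (hne.2 hs), ← uniformOfFinset_map hs (hne.2 hs) e h, PMF.map_comp,
      PMF.map_comp]
    rfl
  · rw [dif_neg hs, dif_neg fun h' => hs (hne.1 h'), PMF.pure_map, Option.map_none]

variable {m n : ℕ}

/-- Rename the reviewers of a triple. -/
def relabelTriple (n : ℕ) (σ : Equiv.Perm (Fin m)) : Triple m n ≃ Triple m n :=
  σ.prodCongr ((Equiv.refl _).prodCongr σ)

/-- Rename the reviewers of a set of triples. -/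
def relabelTriples (n : ℕ) (σ : Equiv.Perm (Fin m)) : Finset (Triple m n) ≃ Finset (Triple m n) :=
  (relabelTriple n σ).finsetCongr

/-- Rename the reviewers of an assignment. -/
def relabelAssignment (n : ℕ) (σ : Equiv.Perm (Fin m)) : Assignment m n ≃ Assignment m n :=
  (σ.prodCongr (Equiv.refl (Fin n))).finsetCongr

@[simp] theorem relabelTriple_apply (σ : Equiv.Perm (Fin m)) (t : Triple m n) :
    relabelTriple n σ t = (σ t.1, t.2.1, σ t.2.2) := rfl

@[simp] theorem mem_relabelAssignment (σ : Equiv.Perm (Fin m)) (A : Assignment m n)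
    (e : Fin m × Fin n) : e ∈ relabelAssignment n σ A ↔ (σ.symm e.1, e.2) ∈ A := by
  simp only [relabelAssignment, Equiv.finsetCongr_apply, Finset.mem_map_equiv]
  rfl

@[simp] theorem mem_relabelTriples (σ : Equiv.Perm (Fin m)) (T : Finset (Triple m n))
    (t : Triple m n) : t ∈ relabelTriples n σ T ↔ (σ.symm t.1, t.2.1, σ.symm t.2.2) ∈ T := by
  simp only [relabelTriples, Equiv.finsetCongr_apply, Finset.mem_map_equiv]
  rfl

@[simp] theorem mem_finsetCongr_perm (σ : Equiv.Perm (Fin m)) (R : Finset (Fin m)) (i : Fin m) :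
    i ∈ σ.finsetCongr R ↔ σ.symm i ∈ R := by
  simp only [Equiv.finsetCongr_apply, Finset.mem_map_equiv]

theorem card_relabelAssignment (σ : Equiv.Perm (Fin m)) (A : Assignment m n) :
    (relabelAssignment n σ A).card = A.card := by
  simp [relabelAssignment]

theorem paths_relabel (σ : Equiv.Perm (Fin m)) (A A' : Assignment m n) :
    paths (relabelAssignment n σ A) (relabelAssignment n σ A') =
      relabelTriples n σ (paths A A') := by
  ext t
  simp [paths]

theorem reviewersOf_relabel (σ : Equiv.Perm (Fin m)) (A : Assignment m n) (j : Fin n) :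
    reviewersOf (relabelAssignment n σ A) j = σ.finsetCongr (reviewersOf A j) := by
  ext i
  simp [reviewersOf, -Equiv.finsetCongr_apply]

theorem papersOf_relabel (σ : Equiv.Perm (Fin m)) (A : Assignment m n) (i : Fin m) :
    papersOf (relabelAssignment n σ A) (σ i) = papersOf A i := by
  ext i
  simp [papersOf]

theorem finsetCongr_mem_halves (σ : Equiv.Perm (Fin m)) (R : Finset (Fin m)) :
    σ.finsetCongr R ∈ halves m ↔ R ∈ halves m := by
  simp [halves]

theorem relabel_mem_validAssignments (lam mu : ℕ) (σ : Equiv.Perm (Fin m)) (R : Finset (Fin m))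
    (A : Assignment m n) : relabelAssignment n σ A ∈ validAssignments n lam mu (σ.finsetCongr R) ↔
      A ∈ validAssignments n lam mu R := by
  simp only [validAssignments, Finset.mem_filter, Finset.mem_univ, true_and, reviewersOf_relabel,
    mem_relabelAssignment, mem_finsetCongr_perm]
  rw [σ.surjective.forall (p := fun i => (papersOf (relabelAssignment n σ A) i).card ≤ mu)]
  simp only [papersOf_relabel]
  refine and_congr ⟨fun h e he => ?_, fun h e he => h _ he⟩ (and_congr ?_ Iff.rfl)
  · simpa [-Equiv.finsetCongr_apply] using h (σ e.1, e.2) (by simpa using he)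
  · simp

theorem compl_finsetCongr (σ : Equiv.Perm (Fin m)) (R : Finset (Fin m)) :
    (σ.finsetCongr R)ᶜ = σ.finsetCongr Rᶜ := by
  ext i
  simp [-Equiv.finsetCongr_apply]

theorem isMatching_relabel (σ : Equiv.Perm (Fin m)) (M : Assignment m n) :
    IsMatching (relabelAssignment n σ M) ↔ IsMatching M := by
  have h : ∀ (P : Fin m × Fin n → Prop), (∀ e, P e) ↔ ∀ e : Fin m × Fin n, P (σ e.1, e.2) :=
    fun P => (σ.prodCongr (Equiv.refl (Fin n))).surjective.forall
  unfold IsMatching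
  rw [h]
  refine forall_congr' fun e => ?_
  rw [mem_relabelAssignment, h]
  simp [Prod.ext_iff]

theorem relabel_subset (σ : Equiv.Perm (Fin m)) (M A : Assignment m n) :
    relabelAssignment n σ M ⊆ relabelAssignment n σ A ↔ M ⊆ A := by
  simp [relabelAssignment, Finset.map_subset_map]

theorem relabel_mem_maximumMatchings (σ : Equiv.Perm (Fin m)) (A M : Assignment m n) :
    relabelAssignment n σ M ∈ maximumMatchings (relabelAssignment n σ A) ↔
      M ∈ maximumMatchings A := by
  simp only [maximumMatchings, Finset.mem_filter, Finset.mem_univ, true_and, relabel_subset,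
    isMatching_relabel, card_relabelAssignment]
  rw [(relabelAssignment n σ).surjective.forall]
  simp only [relabel_subset, isMatching_relabel, card_relabelAssignment]

theorem relabelAssignment_default (σ : Equiv.Perm (Fin m)) :
    relabelAssignment n σ default = default := by
  simp only [relabelAssignment, Equiv.finsetCongr_apply]
  rfl

theorem exactMatching_relabel (σ : Equiv.Perm (Fin m)) (A A' : Assignment m n) :
    (exactMatching A A').map (relabelTriples n σ) =
      exactMatching (relabelAssignment n σ A) (relabelAssignment n σ A') := by
  refine map_bind_of (relabelAssignment n σ) _ (uniformOn_map _ (relabelAssignment_default σ)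
    fun M => relabel_mem_maximumMatchings σ A M) fun M => ?_
  refine map_bind_of (relabelAssignment n σ) _ (uniformOn_map _ (relabelAssignment_default σ)
    fun M => relabel_mem_maximumMatchings σ A' M) fun M' => ?_
  rw [PMF.pure_map, paths_relabel]

theorem deleteReviewers_relabel (σ : Equiv.Perm (Fin m)) (t : Option (Triple m n))
    (A : Assignment m n) :
    deleteReviewers (t.map (relabelTriple n σ)) (relabelAssignment n σ A) =
      relabelAssignment n σ (deleteReviewers t A) := by
  ext e
  cases t <;> simp [deleteReviewers, Equiv.symm_apply_eq]

/-- Every draw is uniform on a set defined by incidences alone, and renaming commutes with deletion,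
so each round is equivariant. -/
theorem greedyLoop_relabel (σ : Equiv.Perm (Fin m)) (J : Finset (Fin n)) (fuel : ℕ) :
    ∀ (A A' : Assignment m n) (T : Finset (Triple m n)),
    (greedyLoop J fuel A A' T).map (relabelTriples n σ) =
      greedyLoop J fuel (relabelAssignment n σ A) (relabelAssignment n σ A')
        (relabelTriples n σ T) := by
  induction fuel with
  | zero =>
    intro A A' T
    rw [greedyLoop, greedyLoop, PMF.pure_map]
  | succ fuel ih =>
    intro A A' T
    rw [greedyLoop, greedyLoop]
    refine map_bind_of (Option.map (relabelTriple n σ)) _ (uniformOption_map _ fun t => ?_)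
      fun t₁ => map_bind_of (Option.map (relabelTriple n σ)) _ (uniformOption_map _ fun t => ?_)
      fun t₂ => ?_
    · simp [paths_relabel]
    · cases t₁ <;> simp [paths_relabel]
    · simp only [Option.map_eq_none_iff, apply_ite, deleteReviewers_relabel]
      split_ifs
      · rw [PMF.pure_map]
      · rw [ih]
        congr 1
        ext t
        cases t₁ <;> cases t₂ <;> simp [Prod.ext_iff, Equiv.eq_symm_apply, eq_comm]

theorem matchingProcedure_relabel (lam mu : ℕ) (σ : Equiv.Perm (Fin m)) (J : Finset (Fin n))
    (A A' : Assignment m n) :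
    (matchingProcedure lam mu J A A').map (relabelTriples n σ) =
      matchingProcedure lam mu J (relabelAssignment n σ A) (relabelAssignment n σ A') := by
  unfold matchingProcedure greedyMatching
  split_ifs
  · exact exactMatching_relabel σ A A'
  · rw [greedyLoop_relabel, card_relabelAssignment]
    congr 1

/-- The law of the set of triples. -/
def tripleLaw (lam mu : ℕ) (J : Finset (Fin n)) : PMF (Finset (Triple m n)) :=
  (uniformOn (halves m)).bind fun R =>
  (uniformOn (validAssignments n lam mu R)).bind fun ASB =>
  (uniformOn (validAssignments n lam mu Rᶜ)).bind fun ADB =>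
  matchingProcedure lam mu J ASB ADB

/-- Halves, valid assignments and the matching procedure are all defined without reference to
reviewer names, while the papers and `J` stay fixed. -/
theorem tripleLaw_relabel (lam mu : ℕ) (σ : Equiv.Perm (Fin m)) (J : Finset (Fin n))
    (T : Finset (Triple m n)) :
    tripleLaw lam mu J (relabelTriples n σ T) = tripleLaw lam mu J T := by
  have : (tripleLaw lam mu J).map (relabelTriples n σ) = tripleLaw lam mu J := by
    refine map_bind_of σ.finsetCongr _ (uniformOn_map _ ?_ (finsetCongr_mem_halves σ)) fun R => ?_
    · simp only [Equiv.finsetCongr_apply]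
      rfl
    refine map_bind_of (relabelAssignment n σ) _ (uniformOn_map _ (relabelAssignment_default σ)
      (relabel_mem_validAssignments lam mu σ R)) fun A => ?_
    refine map_bind_of (relabelAssignment n σ) _ (uniformOn_map _ (relabelAssignment_default σ) ?_)
      fun A' => matchingProcedure_relabel lam mu σ J A A'
    intro A
    rw [compl_finsetCongr, relabel_mem_validAssignments]
  conv_lhs => rw [← this]
  exact map_equiv_apply _ _ _

/-! ## Supports -/

theorem mem_support_uniformOn {β : Type} [Inhabited β] {s : Finset β} (hs : s.Nonempty) {x : β}
    (hx : x ∈ (uniformOn s).support) : x ∈ s := by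
  rwa [uniformOn, dif_pos hs, PMF.mem_support_uniformOfFinset_iff] at hx

theorem mem_of_some_mem_support {β : Type} {s : Finset β} {x : β}
    (hx : some x ∈ (uniformOption s).support) : x ∈ s := by
  unfold uniformOption at hx
  split_ifs at hx with h
  · rw [PMF.mem_support_map_iff] at hx
    obtain ⟨y, hy, hxy⟩ := hx
    rw [PMF.mem_support_uniformOfFinset_iff] at hy
    rwa [← Option.some.inj hxy]
  · simp at hx

theorem eq_empty_of_none_mem_support {β : Type} {s : Finset β}
    (hx : none ∈ (uniformOption s).support) : s = ∅ := by
  unfold uniformOption at hx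
  split_ifs at hx with h
  · simp at hx
  · exact Finset.not_nonempty_iff_eq_empty.1 h

/-- If the experiment can be carried out, each half of the reviewers admits a valid assignment. -/
theorem Feasible.nonempty_validAssignments {lam mu : ℕ} (h : Feasible m n lam mu)
    {R : Finset (Fin m)} (hR : R ∈ halves m) : (validAssignments n lam mu R).Nonempty := by
  obtain ⟨R₀, hR₀, A, hA⟩ := h
  have hc : R₀.card = R.card := by
    simp only [halves, Finset.mem_filter, Finset.mem_univ, true_and] at hR hR₀
    omega
  -- Any two halves differ by a renaming of reviewers, which carries valid assignments along.
  obtain ⟨σ, hσ⟩ : ∃ σ : Equiv.Perm (Fin m), σ.finsetCongr R₀ = R := by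
    let e : R₀ ≃ R := Finset.equivOfCardEq hc
    obtain ⟨σ, hσ⟩ := exists_perm_comp (g := fun x : R₀ => (x : Fin m))
      (g' := fun x : R₀ => (e x : Fin m)) Subtype.val_injective
      (Subtype.val_injective.comp e.injective)
    refine ⟨σ, Finset.eq_of_subset_of_card_le (fun i hi => ?_) (by simp [hc])⟩
    rw [mem_finsetCongr_perm] at hi
    have := hσ ⟨_, hi⟩
    simp only [Equiv.apply_symm_apply] at this
    rw [this]
    exact (e _).2
  exact ⟨relabelAssignment n σ A, by rwa [← hσ, relabel_mem_validAssignments]⟩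

theorem compl_mem_halves {R : Finset (Fin m)} (hR : R ∈ halves m) : Rᶜ ∈ halves m := by
  simp only [halves, Finset.mem_filter, Finset.mem_univ, true_and, Finset.card_compl,
    Fintype.card_fin] at hR ⊢
  omega

/-! ## The matching procedures produce many triples with disjoint reviewers -/

/-- No reviewer occurs twice on the same side. -/
def SidewiseDisjoint (T : Finset (Triple m n)) : Prop :=
  ∀ t ∈ T, ∀ t' ∈ T, t.1 = t'.1 ∨ t.2.2 = t'.2.2 → t = t'

theorem mem_paths {A A' : Assignment m n} {t : Triple m n} :
    t ∈ paths A A' ↔ (t.1, t.2.1) ∈ A ∧ (t.2.2, t.2.1) ∈ A' := by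
  simp [paths]

/-- A shared reviewer on one side forces a common paper through that matching, and the paper forces
the other reviewer. -/
theorem sidewiseDisjoint_paths {M M' : Assignment m n} (hM : IsMatching M) (hM' : IsMatching M') :
    SidewiseDisjoint (paths M M') := by
  intro t ht t' ht' h
  rw [mem_paths] at ht ht'
  rcases h with h | h
  · have h1 := hM _ ht.1 _ ht'.1 (Or.inl h)
    have h2 : t.2.1 = t'.2.1 := congrArg Prod.snd h1
    have h3 := hM' _ ht.2 _ ht'.2 (Or.inr h2)
    exact Prod.ext h (Prod.ext h2 (congrArg Prod.fst h3))
  · have h1 := hM' _ ht.2 _ ht'.2 (Or.inl h)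
    have h2 : t.2.1 = t'.2.1 := congrArg Prod.snd h1
    have h3 := hM _ ht.1 _ ht'.1 (Or.inr h2)
    exact Prod.ext (Prod.ext_iff.1 h3).1 (Prod.ext h2 h)

/-- If papers have larger degrees than reviewers, some matching saturates the papers. -/
theorem exists_injective_reviewer {lam mu : ℕ} (hlam : 1 ≤ lam) (hle : mu ≤ lam)
    {A : Assignment m n} (hr : ∀ j, (reviewersOf A j).card = lam)
    (hp : ∀ i, (papersOf A i).card ≤ mu) :
    ∃ f : Fin n → Fin m, Function.Injective f ∧ ∀ j, (f j, j) ∈ A := by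
  classical
  -- Counting the edges between `s` and its neighbourhood `N` gives `lam * |s| ≤ mu * |N| ≤ lam *
  -- |N|`, which is Hall's condition.
  have hall : ∀ s : Finset (Fin n), s.card ≤ (s.biUnion (reviewersOf A)).card := fun s => by
    have := Finset.card_mul_le_card_mul (s := s) (t := s.biUnion (reviewersOf A)) (m := lam)
      (n := mu) (fun j i => (i, j) ∈ A) (fun j hj => ?_) fun i _ => ?_
    · refine Nat.le_of_mul_le_mul_right (this.trans (Nat.mul_le_mul_left _ hle)) (by omega)
    · rw [← hr j]
      refine Finset.card_le_card fun i hi => ?_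
      rw [Finset.mem_bipartiteAbove]
      exact ⟨Finset.mem_biUnion.2 ⟨j, hj, hi⟩, by simpa [reviewersOf] using hi⟩
    · refine le_trans (Finset.card_le_card fun j hj => ?_) (hp i)
      rw [Finset.mem_bipartiteBelow] at hj
      simpa [papersOf] using hj.2
  obtain ⟨f, hf, hfA⟩ := (Finset.all_card_le_biUnion_card_iff_exists_injective _).1 hall
  exact ⟨f, hf, fun j => by simpa [reviewersOf] using hfA j⟩

theorem maximumMatchings_nonempty (A : Assignment m n) : (maximumMatchings A).Nonempty := by
  classical
  obtain ⟨M, hM, hmax⟩ := Finset.exists_max_image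
    (Finset.univ.filter fun M : Assignment m n => M ⊆ A ∧ IsMatching M) Finset.card
    ⟨∅, by simp [IsMatching]⟩
  rw [Finset.mem_filter] at hM
  refine ⟨M, ?_⟩
  simp only [maximumMatchings, Finset.mem_filter, Finset.mem_univ, true_and]
  exact ⟨hM.2.1, hM.2.2, fun M' h1 h2 => hmax M' (by simp [h1, h2])⟩

/-- The matching from Hall's theorem has `n` edges, so a maximum one has at least `n`. Its edges
have distinct papers, so every paper occurs. -/
theorem saturating_of_mem_maximumMatchings {lam mu : ℕ} (hlam : 1 ≤ lam) (hle : mu ≤ lam)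
    {A M : Assignment m n} (hr : ∀ j, (reviewersOf A j).card = lam)
    (hp : ∀ i, (papersOf A i).card ≤ mu) (hM : M ∈ maximumMatchings A) (j : Fin n) :
    ∃ i, (i, j) ∈ M := by
  classical
  obtain ⟨f, hf, hfA⟩ := exists_injective_reviewer hlam hle hr hp
  simp only [maximumMatchings, Finset.mem_filter, Finset.mem_univ, true_and] at hM
  obtain ⟨-, hmatch, hmax⟩ := hM
  have hinj : Function.Injective fun j : Fin n => (f j, j) := fun a b h => congrArg Prod.snd h
  have hn : n ≤ M.card := by
    have := hmax (Finset.univ.image fun j => (f j, j)) (fun e he => ?_) fun e he e' he' h => ?_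
    · rwa [Finset.card_image_of_injective _ hinj, Finset.card_univ, Fintype.card_fin] at this
    · obtain ⟨j, -, rfl⟩ := Finset.mem_image.1 he
      exact hfA j
    · obtain ⟨a, -, rfl⟩ := Finset.mem_image.1 he
      obtain ⟨b, -, rfl⟩ := Finset.mem_image.1 he'
      rcases h with h | h
      · rw [hf h]
      · simp only at h
        rw [h]
  have himg : M.image Prod.snd = Finset.univ := by
    refine Finset.eq_univ_of_card _ (le_antisymm (Finset.card_le_univ _) ?_)
    rw [Finset.card_image_of_injOn fun e he e' he' h => hmatch e he e' he' (Or.inr h),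
      Fintype.card_fin]
    exact hn
  obtain ⟨e, he, rfl⟩ := Finset.mem_image.1 (himg ▸ Finset.mem_univ j)
  exact ⟨e.1, he⟩

/-- The papers with property `P` that lie on some path. -/
def available (P : Fin n → Prop) [DecidablePred P] (A A' : Assignment m n) : Finset (Fin n) :=
  Finset.univ.filter fun j => P j ∧ (∃ i, (i, j) ∈ A) ∧ ∃ i, (i, j) ∈ A'

theorem available_eq_empty {P : Fin n → Prop} [DecidablePred P] {A A' : Assignment m n}
    (h : ∀ t ∈ paths A A', ¬ P t.2.1) : available P A A' = ∅ := by
  refine Finset.filter_eq_empty_iff.2 fun j _ ⟨hj, ⟨i, hi⟩, i', hi'⟩ => ?_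
  exact h (i, j, i') (mem_paths.2 ⟨hi, hi'⟩) hj

theorem deleteReviewers_subset (t : Option (Triple m n)) (A : Assignment m n) :
    deleteReviewers t A ⊆ A := Finset.filter_subset _ _

theorem papersOf_mono {A B : Assignment m n} (h : A ⊆ B) (i : Fin m) :
    papersOf A i ⊆ papersOf B i := fun j hj => by
  simp only [papersOf, Finset.mem_filter, Finset.mem_univ, true_and] at hj ⊢
  exact h hj

/-- A paper that becomes unavailable was assigned to one of the two deleted reviewers in one of the
two graphs: four sets of at most `mu` papers. -/
theorem card_available_le {mu : ℕ} (P : Fin n → Prop) [DecidablePred P] {A A' : Assignment m n}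
    (hA : ∀ i, (papersOf A i).card ≤ mu) (hA' : ∀ i, (papersOf A' i).card ≤ mu)
    (t : Option (Triple m n)) :
    (available P A A').card ≤
      (available P (deleteReviewers t A) (deleteReviewers t A')).card + 4 * mu := by
  classical
  rcases t with _ | t
  · simp [deleteReviewers]
  · have hsub : available P A A' ⊆
        available P (deleteReviewers (some t) A) (deleteReviewers (some t) A') ∪
        (papersOf A t.1 ∪ papersOf A t.2.2 ∪ (papersOf A' t.1 ∪ papersOf A' t.2.2)) := by
      intro j hj
      simp only [available, papersOf, deleteReviewers, Finset.mem_filter, Finset.mem_univ,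
        true_and, Finset.mem_union, Option.mem_some, forall_eq'] at hj ⊢
      obtain ⟨hP, ⟨i, hi⟩, i', hi'⟩ := hj
      by_contra hcon
      simp only [not_or] at hcon
      obtain ⟨h0, ⟨h1, h2⟩, h3, h4⟩ := hcon
      refine h0 ⟨hP, ⟨i, hi, ?_, ?_⟩, i', hi', ?_, ?_⟩
      · rintro rfl; exact h1 hi
      · rintro rfl; exact h2 hi
      · rintro rfl; exact h3 hi'
      · rintro rfl; exact h4 hi'
    refine (Finset.card_le_card hsub).trans ((Finset.card_union_le _ _).trans ?_)
    have h1 := Finset.card_union_le (papersOf A t.1 ∪ papersOf A t.2.2)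
      (papersOf A' t.1 ∪ papersOf A' t.2.2)
    have h2 := Finset.card_union_le (papersOf A t.1) (papersOf A t.2.2)
    have h3 := Finset.card_union_le (papersOf A' t.1) (papersOf A' t.2.2)
    have := hA t.1
    have := hA t.2.2
    have := hA' t.1
    have := hA' t.2.2
    omega

/-- No edge of `A` uses the SB reviewer and no edge of `A'` uses the DB reviewer of a triple
of `T`. -/
def FreshFor (T : Finset (Triple m n)) (A A' : Assignment m n) : Prop :=
  ∀ s ∈ T, (∀ e ∈ A, e.1 ≠ s.1) ∧ ∀ e ∈ A', e.1 ≠ s.2.2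

/-! ### Disjointness and number of the greedy triples. -/

theorem SidewiseDisjoint.insert {T : Finset (Triple m n)} {A A' : Assignment m n}
    (hT : SidewiseDisjoint T) (hf : FreshFor T A A') {t : Triple m n} (ht : t ∈ paths A A') :
    SidewiseDisjoint (T ∪ {t}) := by
  rw [mem_paths] at ht
  intro s hs s' hs' h
  rw [Finset.mem_union, Finset.mem_singleton] at hs hs'
  rcases hs with hs | rfl <;> rcases hs' with hs' | rfl
  · exact hT s hs s' hs' h
  · rcases h with h | h
    · exact ((hf s hs).1 _ ht.1 h.symm).elim
    · exact ((hf s hs).2 _ ht.2 h.symm).elim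
  · rcases h with h | h
    · exact ((hf s' hs').1 _ ht.1 h).elim
    · exact ((hf s' hs').2 _ ht.2 h).elim
  · rfl

theorem SidewiseDisjoint.union_option {T : Finset (Triple m n)} {A A' : Assignment m n}
    (hT : SidewiseDisjoint T) (hf : FreshFor T A A') {t : Option (Triple m n)}
    (ht : ∀ s ∈ t, s ∈ paths A A') : SidewiseDisjoint (T ∪ t.toFinset) := by
  rcases t with _ | t
  · simpa using hT
  · exact hT.insert hf (ht t rfl)

theorem FreshFor.union_option {T : Finset (Triple m n)} {A A' : Assignment m n}
    (hf : FreshFor T A A') (t : Option (Triple m n)) :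
    FreshFor (T ∪ t.toFinset) (deleteReviewers t A) (deleteReviewers t A') := by
  intro s hs
  rw [Finset.mem_union, Option.mem_toFinset] at hs
  rcases hs with hs | hs
  · exact ⟨fun e he => (hf s hs).1 e (deleteReviewers_subset _ _ he),
      fun e he => (hf s hs).2 e (deleteReviewers_subset _ _ he)⟩
  · exact ⟨fun e he => ((Finset.mem_filter.1 he).2 s hs).1,
      fun e he => ((Finset.mem_filter.1 he).2 s hs).2⟩

theorem deleteReviewers_comm (t t' : Option (Triple m n)) (A : Assignment m n) :
    deleteReviewers t (deleteReviewers t' A) = deleteReviewers t' (deleteReviewers t A) :=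
  Finset.filter_comm _ _ _

theorem FreshFor.notMem {T : Finset (Triple m n)} {A A' : Assignment m n}
    (hf : FreshFor T A A') {t : Triple m n} (ht : t ∈ paths A A') : t ∉ T := fun h =>
  (hf t h).1 _ (mem_paths.1 ht).1 rfl

theorem paths_mono {A B A' B' : Assignment m n} (h : A ⊆ B) (h' : A' ⊆ B') :
    paths A A' ⊆ paths B B' := fun t ht => by
  rw [mem_paths] at ht ⊢
  exact ⟨h ht.1, h' ht.2⟩

/-- A potential argument: a round deletes at most two triples' reviewers and so loses at most `8 *
mu` available papers of each kind. It gains a triple of that kind unless none is found. -/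
theorem greedyLoop_support {mu : ℕ} (J : Finset (Fin n)) (fuel : ℕ) :
    ∀ (A A' : Assignment m n) (T T' : Finset (Triple m n)),
    (∀ i, (papersOf A i).card ≤ mu) → (∀ i, (papersOf A' i).card ≤ mu) → A.card ≤ fuel →
    SidewiseDisjoint T → FreshFor T A A' → T' ∈ (greedyLoop J fuel A A' T).support →
    T ⊆ T' ∧ T' ⊆ T ∪ paths A A' ∧ SidewiseDisjoint T' ∧
    (T.filter fun t => t.2.1 ∈ J).card * (8 * mu) + (available (· ∈ J) A A').card ≤
      (T'.filter fun t => t.2.1 ∈ J).card * (8 * mu) ∧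
    (T.filter fun t => t.2.1 ∉ J).card * (8 * mu) + (available (· ∉ J) A A').card ≤
      (T'.filter fun t => t.2.1 ∉ J).card * (8 * mu) + 4 * mu := by
  classical
  induction fuel with
  | zero =>
    intro A A' T T' _ _ hcard hT _ hT'
    have hA : A = ∅ := Finset.card_eq_zero.1 (Nat.le_zero.1 hcard)
    rw [greedyLoop, PMF.mem_support_pure_iff] at hT'
    subst hT' hA
    refine ⟨subset_rfl, Finset.subset_union_left, hT, ?_, ?_⟩ <;> simp [available]
  | succ fuel ih =>
    intro A A' T T' hA hA' hcard hT hfresh hT'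
    rw [greedyLoop, PMF.mem_support_bind_iff] at hT'
    obtain ⟨t₁, ht₁, hT'⟩ := hT'
    rw [PMF.mem_support_bind_iff] at hT'
    obtain ⟨t₂, ht₂, hT'⟩ := hT'
    split_ifs at hT' with hnone
    · obtain ⟨rfl, rfl⟩ := hnone
      rw [PMF.mem_support_pure_iff] at hT'
      subst hT'
      have h1 := eq_empty_of_none_mem_support ht₁
      have h2 := eq_empty_of_none_mem_support ht₂
      rw [Finset.filter_eq_empty_iff] at h1 h2
      refine ⟨subset_rfl, Finset.subset_union_left, hT, ?_, ?_⟩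
      · rw [available_eq_empty fun t ht => h1 ht]
        simp
      · rw [available_eq_empty fun t ht htJ => h2 ht ⟨htJ, by simp⟩]
        simp
    · set B := deleteReviewers t₁ A
      set B' := deleteReviewers t₁ A'
      have hp₁ : ∀ s ∈ t₁, s ∈ paths A A' ∧ s.2.1 ∈ J := fun s hs => by
        rw [Option.mem_def] at hs
        subst hs
        exact Finset.mem_filter.1 (mem_of_some_mem_support ht₁)
      have hp₂ : ∀ s ∈ t₂, s ∈ paths A A' ∧ s.2.1 ∉ J ∧
          ∀ s' ∈ t₁, s.1 ≠ s'.1 ∧ s.2.2 ≠ s'.2.2 := fun s hs => by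
        rw [Option.mem_def] at hs
        subst hs
        exact Finset.mem_filter.1 (mem_of_some_mem_support ht₂)
      have hsubA : deleteReviewers t₁ (deleteReviewers t₂ A) ⊆ A :=
        (deleteReviewers_subset _ _).trans (deleteReviewers_subset _ _)
      have hsubA' : deleteReviewers t₁ (deleteReviewers t₂ A') ⊆ A' :=
        (deleteReviewers_subset _ _).trans (deleteReviewers_subset _ _)
      -- Each continuing round deletes an SB edge, so the remaining fuel suffices and fuel zero
      -- means that no path is left.
      have hcard' : (deleteReviewers t₁ (deleteReviewers t₂ A)).card ≤ fuel := by
        have hlt : (deleteReviewers t₁ (deleteReviewers t₂ A)).card < A.card := by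
          refine Finset.card_lt_card (Finset.ssubset_iff_subset_ne.2 ⟨hsubA, fun heq => ?_⟩)
          rcases t₁ with _ | s
          · rcases t₂ with _ | s
            · exact hnone ⟨rfl, rfl⟩
            · have hs := (mem_paths.1 (hp₂ s rfl).1).1
              rw [← heq] at hs
              have := (Finset.mem_filter.1 (deleteReviewers_subset _ _ hs)).2 s rfl
              exact this.1 rfl
          · have hs := (mem_paths.1 (hp₁ s rfl).1).1
            rw [← heq] at hs
            exact ((Finset.mem_filter.1 hs).2 s rfl).1 rfl
        omega
      -- The second triple avoids the sides of the reviewers of the first one.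
      have hT₁ : SidewiseDisjoint (T ∪ t₁.toFinset) :=
        hT.union_option hfresh fun s hs => (hp₁ s hs).1
      have hT₂ : SidewiseDisjoint (T ∪ t₁.toFinset ∪ t₂.toFinset) := by
        intro s hs s' hs' h
        rw [Finset.mem_union] at hs hs'
        have aux : ∀ s ∈ T ∪ t₁.toFinset, ∀ s' ∈ t₂.toFinset,
            ¬ (s.1 = s'.1 ∨ s.2.2 = s'.2.2) := fun s hs s' hs' h => by
          rw [Option.mem_toFinset] at hs'
          obtain ⟨q1, -, q2⟩ := hp₂ s' hs'
          rw [mem_paths] at q1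
          rw [Finset.mem_union, Option.mem_toFinset] at hs
          rcases hs with hs | hs
          · rcases h with h | h
            · exact (hfresh s hs).1 _ q1.1 h.symm
            · exact (hfresh s hs).2 _ q1.2 h.symm
          · rcases h with h | h
            · exact (q2 s hs).1 h.symm
            · exact (q2 s hs).2 h.symm
        rcases hs with hs | hs <;> rcases hs' with hs' | hs'
        · exact hT₁ s hs s' hs' h
        · exact (aux s hs s' hs' h).elim
        · exact (aux s' hs' s hs (h.imp Eq.symm Eq.symm)).elim
        · rw [Option.mem_toFinset, Option.mem_def] at hs hs'
          exact Option.some.inj (hs.symm.trans hs')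
      have hfresh₂ : FreshFor (T ∪ t₁.toFinset ∪ t₂.toFinset)
          (deleteReviewers t₁ (deleteReviewers t₂ A))
          (deleteReviewers t₁ (deleteReviewers t₂ A')) := by
        rw [deleteReviewers_comm t₁ t₂ A, deleteReviewers_comm t₁ t₂ A']
        exact (hfresh.union_option t₁).union_option t₂
      obtain ⟨i1, i2, i3, i4, i5⟩ := ih _ _ _ _
        (fun i => (Finset.card_le_card (papersOf_mono hsubA i)).trans (hA i))
        (fun i => (Finset.card_le_card (papersOf_mono hsubA' i)).trans (hA' i))
        hcard' hT₂ hfresh₂ hT'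
      have hTsub : T ⊆ T' := fun s hs => i1 (by simp [hs])
      have hdrop : ∀ (P : Fin n → Prop) [DecidablePred P], (available P A A').card ≤
          (available P (deleteReviewers t₁ (deleteReviewers t₂ A))
            (deleteReviewers t₁ (deleteReviewers t₂ A'))).card + 8 * mu := fun P _ => by
        have h1 := card_available_le P hA hA' t₂
        have h2 := card_available_le P (mu := mu)
          (fun i => (Finset.card_le_card (papersOf_mono (deleteReviewers_subset t₂ A) i)).trans
            (hA i))
          (fun i => (Finset.card_le_card (papersOf_mono (deleteReviewers_subset t₂ A') i)).trans
            (hA' i)) t₁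
        omega
      have hgain : ∀ (P : Fin n → Prop) [DecidablePred P] (t : Triple m n),
          t ∈ paths A A' → P t.2.1 → t ∈ T ∪ t₁.toFinset ∪ t₂.toFinset →
          (T.filter fun t => P t.2.1).card + 1 ≤
            ((T ∪ t₁.toFinset ∪ t₂.toFinset).filter fun t => P t.2.1).card :=
        fun P _ t ht hP htm => by
          rw [← Finset.card_insert_of_notMem (a := t) (s := T.filter fun t => P t.2.1)
            fun h => hfresh.notMem ht (Finset.mem_filter.1 h).1]
          refine Finset.card_le_card fun s hs => ?_
          rw [Finset.mem_insert, Finset.mem_filter] at hs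
          rw [Finset.mem_filter]
          rcases hs with rfl | hs
          · exact ⟨htm, hP⟩
          · exact ⟨by simp [hs.1], hs.2⟩
      refine ⟨hTsub, fun s hs => ?_, i3, ?_, ?_⟩
      · have := i2 hs
        simp only [Finset.mem_union, Option.mem_toFinset] at this ⊢
        rcases this with ((h | h) | h) | h
        · exact Or.inl h
        · exact Or.inr (hp₁ s h).1
        · exact Or.inr (hp₂ s h).1
        · exact Or.inr (paths_mono hsubA hsubA' h)
      · rcases t₁ with _ | t
        · have h1 := eq_empty_of_none_mem_support ht₁
          rw [Finset.filter_eq_empty_iff] at h1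
          rw [available_eq_empty fun t ht => h1 ht, Finset.card_empty, add_zero]
          exact Nat.mul_le_mul_right _ (Finset.card_le_card (Finset.filter_subset_filter _ hTsub))
        · have h1 := hgain (· ∈ J) t (hp₁ t rfl).1 (hp₁ t rfl).2 (by simp)
          have h2 := hdrop (· ∈ J)
          have h3 := Nat.mul_le_mul_right (8 * mu) h1
          rw [add_mul, one_mul] at h3
          omega
      · rcases t₂ with _ | t
        · have h1 := eq_empty_of_none_mem_support ht₂
          rw [Finset.filter_eq_empty_iff] at h1
          -- The second search excludes the reviewers of `t₁`, so its failure leaves only papers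
          -- that their deletion makes unavailable. This is the source of the slack `4 * mu`.
          have h2 : (available (· ∉ J) A A').card ≤ 4 * mu := by
            have := card_available_le (· ∉ J) hA hA' t₁
            rw [available_eq_empty (A := deleteReviewers t₁ A), Finset.card_empty,
              zero_add] at this
            · exact this
            · intro s hs hsJ
              refine h1 (paths_mono (deleteReviewers_subset _ _) (deleteReviewers_subset _ _) hs)
                ⟨hsJ, fun s' hs' => ?_⟩
              rw [mem_paths] at hs
              exact ⟨((Finset.mem_filter.1 hs.1).2 s' hs').1,
                ((Finset.mem_filter.1 hs.2).2 s' hs').2⟩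
          exact add_le_add (Nat.mul_le_mul_right _
            (Finset.card_le_card (Finset.filter_subset_filter _ hTsub))) h2
        · have h1 := hgain (· ∉ J) t (hp₂ t rfl).1 (hp₂ t rfl).2.1 (by simp)
          have h2 := hdrop (· ∉ J)
          have h3 := Nat.mul_le_mul_right (8 * mu) h1
          rw [add_mul, one_mul] at h3
          omega

theorem exactMatching_support {lam mu : ℕ} (hlam : 1 ≤ lam) (hle : mu ≤ lam)
    {A A' : Assignment m n} (hr : ∀ j, (reviewersOf A j).card = lam)
    (hp : ∀ i, (papersOf A i).card ≤ mu) (hr' : ∀ j, (reviewersOf A' j).card = lam)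
    (hp' : ∀ i, (papersOf A' i).card ≤ mu) {T : Finset (Triple m n)}
    (hT : T ∈ (exactMatching A A').support) :
    T ⊆ paths A A' ∧ SidewiseDisjoint T ∧ ∀ (P : Fin n → Prop) [DecidablePred P],
      (Finset.univ.filter P).card ≤ (T.filter fun t => P t.2.1).card := by
  classical
  rw [exactMatching, PMF.mem_support_bind_iff] at hT
  obtain ⟨M, hM, hT⟩ := hT
  rw [PMF.mem_support_bind_iff] at hT
  obtain ⟨M', hM', hT⟩ := hT
  rw [PMF.mem_support_pure_iff] at hT
  subst hT
  replace hM := mem_support_uniformOn (maximumMatchings_nonempty A) hM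
  replace hM' := mem_support_uniformOn (maximumMatchings_nonempty A') hM'
  have hs := saturating_of_mem_maximumMatchings hlam hle hr hp hM
  have hs' := saturating_of_mem_maximumMatchings hlam hle hr' hp' hM'
  simp only [maximumMatchings, Finset.mem_filter, Finset.mem_univ, true_and] at hM hM'
  refine ⟨paths_mono hM.1 hM'.1, sidewiseDisjoint_paths hM.2.1 hM'.2.1, fun P _ => ?_⟩
  refine (Finset.card_le_card fun j hj => ?_).trans
    (Finset.card_image_le (f := fun t : Triple m n => t.2.1))
  obtain ⟨i, hi⟩ := hs j
  obtain ⟨i', hi'⟩ := hs' j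
  exact Finset.mem_image.2 ⟨(i, j, i'),
    Finset.mem_filter.2 ⟨mem_paths.2 ⟨hi, hi'⟩, (Finset.mem_filter.1 hj).2⟩, rfl⟩

theorem matchingProcedure_support {lam mu : ℕ} (hlam : 1 ≤ lam) (hmu : 1 ≤ mu)
    (J : Finset (Fin n)) {A A' : Assignment m n} (hr : ∀ j, (reviewersOf A j).card = lam)
    (hp : ∀ i, (papersOf A i).card ≤ mu) (hr' : ∀ j, (reviewersOf A' j).card = lam)
    (hp' : ∀ i, (papersOf A' i).card ≤ mu) {T : Finset (Triple m n)}
    (hT : T ∈ (matchingProcedure lam mu J A A').support) :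
    T ⊆ paths A A' ∧ SidewiseDisjoint T ∧
      J.card ≤ (T.filter fun t => t.2.1 ∈ J).card * (8 * mu) + 4 * mu ∧
      Jᶜ.card ≤ (T.filter fun t => t.2.1 ∉ J).card * (8 * mu) + 4 * mu := by
  classical
  have hJ : (Finset.univ.filter (· ∈ J)) = J := by simp
  have hJc : (Finset.univ.filter (· ∉ J)) = Jᶜ := by
    ext
    simp
  unfold matchingProcedure at hT
  split_ifs at hT with hle
  · obtain ⟨h1, h2, h3⟩ := exactMatching_support hlam hle hr hp hr' hp' hT
    refine ⟨h1, h2, ?_, ?_⟩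
    · have := h3 (· ∈ J)
      rw [hJ] at this
      nlinarith
    · have := h3 (· ∉ J)
      rw [hJc] at this
      nlinarith
  · obtain ⟨-, h2, h3, h4, h5⟩ := greedyLoop_support J A.card A A' ∅ T hp hp' le_rfl
      (by simp [SidewiseDisjoint]) (by simp [FreshFor]) hT
    have hex : ∀ (B : Assignment m n), (∀ j, (reviewersOf B j).card = lam) → ∀ j,
        ∃ i, (i, j) ∈ B := fun B hB j => by
      obtain ⟨i, hi⟩ := Finset.card_pos.1 (hlam.trans_eq (hB j).symm)
      exact ⟨i, by simpa [reviewersOf] using hi⟩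
    have hav : ∀ (P : Fin n → Prop) [DecidablePred P],
        available P A A' = Finset.univ.filter P := fun P _ => by
      ext j
      simp [available, hex A hr j, hex A' hr' j]
    rw [hav, hJ] at h4
    rw [hav, hJc] at h5
    refine ⟨by simpa using h2, h3, ?_, ?_⟩
    · simpa using h4.trans (Nat.le_add_right _ _)
    · simpa using h5

/-! ## The rejection probability given the triples -/

/-- The law of a decision with acceptance probability `p`. -/
def bern (p : unitInterval) (b : Bool) : ℝ := if b then (p : ℝ) else 1 - (p : ℝ)

theorem bern_nonneg (p : unitInterval) (b : Bool) : 0 ≤ bern p b := by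
  cases b
  · simpa [bern] using p.2.2
  · simpa [bern] using p.2.1

theorem expect_map {α β : Type} [Fintype α] [Fintype β] (p : PMF α) (g : α → β) (f : β → ℝ) :
    expect (p.map g) f = expect p fun a => f (g a) := by
  change expect (p.bind fun a => PMF.pure (g a)) f = _
  rw [expect_bind]
  simp only [expect_pure]

theorem sum_marginal {p : PMF (Fin n → Bool)} {j : Fin n} {q : unitInterval}
    (h : p.map (fun d => d j) true = ENNReal.ofReal q) (b : Bool) :
    ∑ d, (p d).toReal * (if d j = b then 1 else 0) = bern q b := by
  have h1 := expect_map p (fun d => d j) fun c => if c = b then 1 else 0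
  have htrue : (p.map (fun d => d j) true).toReal = q := by
    rw [h, ENNReal.toReal_ofReal q.2.1]
  have hsum := sum_toReal (p.map fun d => d j)
  rw [Fintype.sum_bool, htrue] at hsum
  refine h1.symm.trans ?_
  rw [expect, Fintype.sum_bool, htrue]
  cases b
  · simp only [Bool.true_eq_false, if_false, mul_zero, if_true, mul_one, zero_add, bern,
      Bool.false_eq_true]
    linarith
  · simp [bern]

/-- The joint weight of the decisions of the reviewers of a triple. -/
def pairWeight (Psb Pdb : Matrix (Fin m) (Fin n) unitInterval) (t : Triple m n)
    (z : Bool × Bool) : ℝ :=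
  bern (Psb t.1 t.2.1) z.1 * bern (Pdb t.2.2 t.2.1) z.2

/-- The tuples arising from a family of triples with given pairs of decisions. -/
def familyTuples {κ : Type} (J : Finset (Fin n)) (a : κ → Triple m n) (z : κ → Bool × Bool) :
    κ → ReviewTuple n := fun k =>
  { paper := (a k).2.1
    Y := (z k).1
    X := (z k).2
    w := if (a k).2.1 ∈ J then 1 else -1 }

open Classical in
/-- The weight of rejection when the pairs of decisions are independent with weights `W`. -/
def rejectWeight {κ : Type} [Fintype κ] (test : StatTest) (J : Finset (Fin n))
    (W : Triple m n → Bool × Bool → ℝ) (a : κ → Triple m n) : ℝ :=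
  ∑ z : κ → Bool × Bool, (∏ k, W (a k) (z k)) * if test n κ (familyTuples J a z) then 1 else 0

open Classical in
theorem rejectWeight_eq {κ : Type} [Fintype κ] [inst : DecidableEq κ] (test : StatTest)
    (J : Finset (Fin n)) (W : Triple m n → Bool × Bool → ℝ) (a : κ → Triple m n) :
    rejectWeight test J W a = ∑ z : κ → Bool × Bool, (∏ k, W (a k) (z k)) *
      if test n κ (familyTuples J a z) then 1 else 0 := by
  rw [rejectWeight]
  exact Finset.sum_congr (by ext; simp) fun _ _ => rfl

/-- The reviewers of a set of triples. -/
def slot (T : Finset (Triple m n)) : T ⊕ T → Fin m :=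
  Sum.elim (fun t => t.1.1) (fun t => t.1.2.2)

-- Every reviewer fills at most one slot, so only one coordinate of each row is observed. The joint
-- law of the observed decisions is the product of the marginals, whatever the dependence within
-- rows.
open Classical in
theorem expect_decisionLaw {R : Finset (Fin m)} {A A' : Assignment m n}
    (hA : ∀ e ∈ A, e.1 ∈ R) (hA' : ∀ e ∈ A', e.1 ∈ Rᶜ) {T : Finset (Triple m n)}
    (hT : T ⊆ paths A A') (hs : Function.Injective (slot T)) (J : Finset (Fin n))
    {Psb Pdb : Matrix (Fin m) (Fin n) unitInterval} {B : Behaviour m n}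
    (hB : B.HasAcceptProbs Psb Pdb) (test : StatTest) :
    expect (decisionLaw B R A A') (fun D => if test n T (tuplesOf J D T) then 1 else 0) =
      rejectWeight test J (pairWeight Psb Pdb) (fun t : T => t.1) := by
  set ρ : Fin m → PMF (Fin n → Bool) := fun i =>
    if i ∈ R then B i Condition.sb (papersOf A i) else B i Condition.db (papersOf A' i) with hρ
  have hlaw : ∀ D, (decisionLaw B R A A' D).toReal = ∏ i, (ρ i (D i)).toReal := fun D => by
    rw [decisionLaw, indepRows, PMF.ofFintype_apply, ENNReal.toReal_prod]
  have key := sum_prod_mul_comp hs (fun i d => (ρ i d).toReal) (fun i => sum_toReal (ρ i))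
    (fun k d => d (Sum.elim (fun t : T => t.1.2.1) (fun t : T => t.1.2.1) k))
    (fun z => if test n T (familyTuples J (fun t : T => t.1)
      fun t => (z (Sum.inl t), z (Sum.inr t))) then (1 : ℝ) else 0)
  rw [expect]
  simp only [hlaw]
  refine key.trans ?_
  rw [rejectWeight_eq]
  refine Fintype.sum_equiv ((Equiv.sumArrowEquivProdArrow T T Bool).trans
    (Equiv.arrowProdEquivProdArrow T (fun _ => Bool) (fun _ => Bool)).symm) _ _ fun z => ?_
  congr 1
  rw [Fintype.prod_sum_type, ← Finset.prod_mul_distrib]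
  refine Finset.prod_congr rfl fun t _ => ?_
  have ht := mem_paths.1 (hT t.2)
  have h1 : ρ (slot T (Sum.inl t)) = B t.1.1 Condition.sb (papersOf A t.1.1) :=
    if_pos (hA _ ht.1)
  have h2 : ρ (slot T (Sum.inr t)) = B t.1.2.2 Condition.db (papersOf A' t.1.2.2) :=
    if_neg (Finset.mem_compl.1 (hA' _ ht.2))
  rw [h1, h2]
  exact congrArg₂ (· * ·)
    (sum_marginal (hB t.1.1 (papersOf A t.1.1) t.1.2.1 (by simpa [papersOf] using ht.1)).1 _)
    (sum_marginal (hB t.1.2.2 (papersOf A' t.1.2.2) t.1.2.1 (by simpa [papersOf] using ht.2)).2 _)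

/-- SB reviewers lie in `R` and DB reviewers in its complement, so no coincidence occurs across the
sides either. -/
theorem slot_injective {R : Finset (Fin m)} {A A' : Assignment m n}
    (hA : ∀ e ∈ A, e.1 ∈ R) (hA' : ∀ e ∈ A', e.1 ∈ Rᶜ) {T : Finset (Triple m n)}
    (hT : T ⊆ paths A A') (hd : SidewiseDisjoint T) : Function.Injective (slot T) := by
  refine Function.Injective.sumElim (fun t t' h => Subtype.ext (hd _ t.2 _ t'.2 (Or.inl h)))
    (fun t t' h => Subtype.ext (hd _ t.2 _ t'.2 (Or.inr h))) fun t t' h => ?_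
  have h1 := hA _ (mem_paths.1 (hT t.2)).1
  have h2 := hA' _ (mem_paths.1 (hT t'.2)).2
  rw [Finset.mem_compl] at h2
  simp only at h1 h2
  rw [h] at h1
  exact h2 h1

theorem mem_validAssignments {lam mu : ℕ} {R : Finset (Fin m)} {A : Assignment m n} :
    A ∈ validAssignments n lam mu R ↔ (∀ e ∈ A, e.1 ∈ R) ∧
      (∀ j, (reviewersOf A j).card = lam) ∧ ∀ i, (papersOf A i).card ≤ mu := by
  simp [validAssignments]

/-- What is needed of the set of triples: distinct reviewers, and many triples of both kinds. -/
def IsAdmissible (mu : ℕ) (J : Finset (Fin n)) (T : Finset (Triple m n)) : Prop :=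
  Function.Injective (slot T) ∧
    J.card ≤ (T.filter fun t => t.2.1 ∈ J).card * (8 * mu) + 4 * mu ∧
    Jᶜ.card ≤ (T.filter fun t => t.2.1 ∉ J).card * (8 * mu) + 4 * mu

theorem isAdmissible_of_support {lam mu : ℕ} (hlam : 1 ≤ lam) (hmu : 1 ≤ mu)
    {R : Finset (Fin m)} {J : Finset (Fin n)} {A A' : Assignment m n}
    (hA : A ∈ validAssignments n lam mu R) (hA' : A' ∈ validAssignments n lam mu Rᶜ)
    {T : Finset (Triple m n)} (hT : T ∈ (matchingProcedure lam mu J A A').support) :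
    T ⊆ paths A A' ∧ IsAdmissible mu J T := by
  rw [mem_validAssignments] at hA hA'
  obtain ⟨h1, h2, h3, h4⟩ := matchingProcedure_support hlam hmu J hA.2.1 hA.2.2 hA'.2.1 hA'.2.2 hT
  exact ⟨h1, slot_injective hA.1 hA'.1 h1 h2, h3, h4⟩

theorem Feasible.halves_nonempty {lam mu : ℕ} (h : Feasible m n lam mu) : (halves m).Nonempty := by
  obtain ⟨R, hR, -⟩ := h
  exact ⟨R, hR⟩

theorem tripleLaw_support {lam mu : ℕ} (hlam : 1 ≤ lam) (hmu : 1 ≤ mu)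
    (hf : Feasible m n lam mu) {J : Finset (Fin n)} {T : Finset (Triple m n)}
    (hT : T ∈ (tripleLaw lam mu J).support) : IsAdmissible mu J T := by
  rw [tripleLaw, PMF.mem_support_bind_iff] at hT
  obtain ⟨R, hR, hT⟩ := hT
  rw [PMF.mem_support_bind_iff] at hT
  obtain ⟨A, hA, hT⟩ := hT
  rw [PMF.mem_support_bind_iff] at hT
  obtain ⟨A', hA', hT⟩ := hT
  replace hR := mem_support_uniformOn hf.halves_nonempty hR
  replace hA := mem_support_uniformOn (hf.nonempty_validAssignments hR) hA
  replace hA' := mem_support_uniformOn (hf.nonempty_validAssignments (compl_mem_halves hR)) hA'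
  exact (isAdmissible_of_support hlam hmu hA hA' hT).2

theorem rejectProb_eq_expect {lam mu : ℕ} (hlam : 1 ≤ lam) (hmu : 1 ≤ mu)
    (hf : Feasible m n lam mu) (J : Finset (Fin n))
    {Psb Pdb : Matrix (Fin m) (Fin n) unitInterval} {B : Behaviour m n}
    (hB : B.HasAcceptProbs Psb Pdb) (test : StatTest) :
    rejectProb lam mu J B test = expect (tripleLaw lam mu J) fun T =>
      rejectWeight test J (pairWeight Psb Pdb) (fun t : T => t.1) := by
  rw [rejectProb, toReal_bool_true, experiment, tripleLaw]
  simp only [expect_bind, expect_pure, decide_eq_true_eq]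
  refine expect_congr _ fun R hR => expect_congr _ fun A hA => expect_congr _ fun A' hA' =>
    expect_congr _ fun T hT => ?_
  replace hR := mem_support_uniformOn hf.halves_nonempty hR
  replace hA := mem_support_uniformOn (hf.nonempty_validAssignments hR) hA
  replace hA' := mem_support_uniformOn (hf.nonempty_validAssignments (compl_mem_halves hR)) hA'
  obtain ⟨h1, h2, -⟩ := isAdmissible_of_support hlam hmu hA hA' hT
  refine Eq.trans (expect_congr _ fun D _ => ?_)
    (expect_decisionLaw (mem_validAssignments.1 hA).1 (mem_validAssignments.1 hA').1 h1 h2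
      J hB test)
  by_cases h : test n T (tuplesOf J D T) <;> simp [h]

/-! ## Symmetrization: exchanging the two reviewers of a triple -/

/-- Exchange the reviewers of a triple. -/
def swapTriple (b : Bool) (t : Triple m n) : Triple m n :=
  if b then (t.2.2, t.2.1, t.1) else t

@[simp] theorem swapTriple_paper (b : Bool) (t : Triple m n) : (swapTriple b t).2.1 = t.2.1 := by
  cases b <;> rfl

/-- Exchange the reviewers of the triples selected by `s`. -/
def exchange (n : ℕ) (s : Fin m → Bool) : Triple m n ≃ Triple m n :=
  -- The coin is indexed by the smaller reviewer label, which the exchange preserves. This makes the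
  -- map an involution on all triples, defined independently of `T`.
  Function.Involutive.toPerm (fun t => swapTriple (s (min t.1 t.2.2)) t) fun t => by
    cases h : s (min t.1 t.2.2) <;> simp [swapTriple, h, min_comm]

theorem exchange_apply (s : Fin m → Bool) (t : Triple m n) :
    exchange n s t = swapTriple (s (min t.1 t.2.2)) t := rfl

/-- Exchange the reviewers of the selected triples of a set of triples. -/
def exchangeSet (n : ℕ) (s : Fin m → Bool) : Finset (Triple m n) ≃ Finset (Triple m n) :=
  (exchange n s).finsetCongr

theorem exchangeSet_exchangeSet (s : Fin m → Bool) (T : Finset (Triple m n)) :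
    exchangeSet n s (exchangeSet n s T) = T := by
  ext t
  simp only [exchangeSet, Equiv.finsetCongr_apply, Finset.mem_map_equiv]
  rw [show (exchange n s).symm ((exchange n s).symm t) = t from
    (exchange n s).symm_apply_apply t]

/-- With all slots distinct, the required transpositions of slots extend to one permutation of the
reviewers. It depends on `T`. -/
theorem exists_relabel_eq_exchange (s : Fin m → Bool) {T : Finset (Triple m n)}
    (hT : Function.Injective (slot T)) :
    ∃ σ : Equiv.Perm (Fin m), relabelTriples n σ T = exchangeSet n s T := by
  let flip : T ⊕ T → T ⊕ T := fun k =>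
    Sum.elim (fun t : T => if s (min t.1.1 t.1.2.2) then Sum.inr t else Sum.inl t)
      (fun t : T => if s (min t.1.1 t.1.2.2) then Sum.inl t else Sum.inr t) k
  have hflip : Function.Involutive flip := by
    rintro (t | t) <;> cases h : s (min t.1.1 t.1.2.2) <;> simp [flip, h]
  obtain ⟨σ, hσ⟩ := exists_perm_comp hT (hT.comp hflip.injective)
  have h : ∀ t ∈ T, relabelTriple n σ t = exchange n s t := fun t ht => by
    have h1 := hσ (Sum.inl ⟨t, ht⟩)
    have h2 := hσ (Sum.inr ⟨t, ht⟩)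
    cases hs : s (min t.1 t.2.2) <;>
      simp only [slot, Sum.elim_inl, Sum.elim_inr, Function.comp_apply, flip, hs, if_true,
        Bool.false_eq_true, if_false] at h1 h2 <;>
      simp [exchange_apply, swapTriple, hs, h1, h2]
  refine ⟨σ, ?_⟩
  rw [relabelTriples, exchangeSet, Equiv.finsetCongr_apply, Equiv.finsetCongr_apply,
    Finset.map_eq_image, Finset.map_eq_image]
  exact Finset.image_congr fun t ht => h t ht

/-- On the support the exchange is a renaming. Off the support, if the image had positive mass, the
same argument applied to the image would give a contradiction or equality, as the exchange is an
involution. -/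
theorem tripleLaw_exchange {lam mu : ℕ} (hlam : 1 ≤ lam) (hmu : 1 ≤ mu)
    (hf : Feasible m n lam mu) (J : Finset (Fin n)) (s : Fin m → Bool)
    (T : Finset (Triple m n)) :
    tripleLaw lam mu J (exchangeSet n s T) = tripleLaw lam mu J T := by
  have key : ∀ T : Finset (Triple m n), tripleLaw lam mu J T ≠ 0 →
      tripleLaw lam mu J (exchangeSet n s T) = tripleLaw lam mu J T := fun T hT => by
    obtain ⟨σ, hσ⟩ := exists_relabel_eq_exchange s
      (tripleLaw_support hlam hmu hf ((PMF.mem_support_iff _ _).2 hT)).1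
    rw [← hσ, tripleLaw_relabel]
  by_cases h : tripleLaw lam mu J T = 0
  · by_cases h' : tripleLaw lam mu J (exchangeSet n s T) = 0
    · rw [h, h']
    · have := key _ h'
      rw [exchangeSet_exchangeSet] at this
      exact this.symm
  · exact key T h

theorem rejectWeight_comp {κ κ' : Type} [Fintype κ] [Fintype κ'] {test : StatTest}
    (ht : IsReindexInvariant test) (J : Finset (Fin n)) (W : Triple m n → Bool × Bool → ℝ)
    (e : κ ≃ κ') (a : κ' → Triple m n) :
    rejectWeight test J W (fun k => a (e k)) = rejectWeight test J W a := by
  classical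
  unfold rejectWeight
  refine Fintype.sum_equiv (e.arrowCongr (Equiv.refl _)) _ _ fun z => ?_
  have hz : ∀ k, e.arrowCongr (Equiv.refl (Bool × Bool)) z (e k) = z k := fun k => by simp
  have h1 : ∏ k', W (a k') (e.arrowCongr (Equiv.refl (Bool × Bool)) z k') =
      ∏ k, W (a (e k)) (z k) := by
    rw [← Equiv.prod_comp e]
    simp only [hz]
  have h2 : familyTuples J (fun k => a (e k)) z =
      fun k => familyTuples J a (e.arrowCongr (Equiv.refl _) z) (e k) := by
    funext k
    simp only [familyTuples, hz]
  rw [h1, h2]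
  simp only [ht n κ κ' e]

/-- The average of the weights over the exchange of the two reviewers. -/
def symmWeight (W : Triple m n → Bool × Bool → ℝ) (t : Triple m n) (z : Bool × Bool) : ℝ :=
  (W t z + W (swapTriple true t) z) / 2

/-- Distinct reviewers give distinct keys, so each triple has its own fair coin. Papers are
unaffected, so the input of the test is the same and only the weights are averaged. -/
theorem sum_rejectWeight_exchange (test : StatTest) (J : Finset (Fin n))
    (W : Triple m n → Bool × Bool → ℝ) {T : Finset (Triple m n)}
    (hT : Function.Injective (slot T)) :
    ∑ s : Fin m → Bool, (∏ _i : Fin m, (1 / 2 : ℝ)) *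
      rejectWeight test J W (fun t : T => exchange n s t.1) =
    rejectWeight test J (symmWeight W) (fun t : T => t.1) := by
  classical
  let key : T → Fin m := fun t => min t.1.1 t.1.2.2
  have hkey : Function.Injective key := by
    intro t t' h
    have h1 : ∀ t : T, ∃ b : Bool, key t = slot T (if b then Sum.inl t else Sum.inr t) := fun t => by
      rcases min_choice t.1.1 t.1.2.2 with h | h
      · exact ⟨true, h⟩
      · exact ⟨false, h⟩
    obtain ⟨b, hb⟩ := h1 t
    obtain ⟨b', hb'⟩ := h1 t'
    rw [hb, hb'] at h
    have := hT h
    cases b <;> cases b' <;> simp at this <;> exact this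
  have hfam : ∀ (s : Fin m → Bool) (z : T → Bool × Bool),
      familyTuples J (fun t : T => exchange n s t.1) z = familyTuples J (fun t : T => t.1) z :=
    fun s z => by
      funext t
      simp only [familyTuples, exchange_apply, swapTriple_paper]
  simp only [rejectWeight, hfam, Finset.mul_sum]
  rw [Finset.sum_comm]
  refine Finset.sum_congr rfl fun z _ => ?_
  simp only [← mul_assoc]
  rw [← Finset.sum_mul]
  congr 1
  have := sum_prod_mul_prod_comp hkey (fun (_ : Fin m) (_ : Bool) => (1 / 2 : ℝ))
    (fun _ => by norm_num [Fintype.sum_bool]) fun t b => W (swapTriple b t.1) (z t)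
  refine this.trans (Finset.prod_congr rfl fun t _ => ?_)
  rw [Fintype.sum_bool, symmWeight]
  simp only [swapTriple, if_true, Bool.false_eq_true, if_false]
  ring

theorem rejectProb_eq_expect_symm {lam mu : ℕ} (hlam : 1 ≤ lam) (hmu : 1 ≤ mu)
    (hf : Feasible m n lam mu) (J : Finset (Fin n))
    {Psb Pdb : Matrix (Fin m) (Fin n) unitInterval} {B : Behaviour m n}
    (hB : B.HasAcceptProbs Psb Pdb) {test : StatTest} (ht : IsReindexInvariant test) :
    rejectProb lam mu J B test = expect (tripleLaw lam mu J) fun T =>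
      rejectWeight test J (symmWeight (pairWeight Psb Pdb)) (fun t : T => t.1) := by
  set F : Finset (Triple m n) → ℝ := fun T =>
    rejectWeight test J (pairWeight Psb Pdb) (fun t : T => t.1)
  have h1 : ∀ s : Fin m → Bool, expect (tripleLaw lam mu J) F = expect (tripleLaw lam mu J)
      fun T => rejectWeight test J (pairWeight Psb Pdb) (fun t : T => exchange n s t.1) :=
    fun s => by
      rw [expect, expect, ← Equiv.sum_comp (exchangeSet n s)]
      refine Finset.sum_congr rfl fun T _ => ?_
      rw [tripleLaw_exchange hlam hmu hf]
      congr 1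
      -- The families are indexed by different sets of triples, which is where invariance under
      -- reindexing enters.
      exact (rejectWeight_comp ht J (pairWeight Psb Pdb)
        (Equiv.subtypeEquiv (exchange n s) fun t => by
          simp [exchangeSet]) fun t => t.1).symm
  have h2 : ∑ s : Fin m → Bool, (∏ _i : Fin m, (1 / 2 : ℝ)) = 1 :=
    sum_prod_eq_one (fun (_ : Fin m) (_ : Bool) => (1 / 2 : ℝ))
      fun _ => by norm_num [Fintype.sum_bool]
  rw [rejectProb_eq_expect hlam hmu hf J hB]
  calc expect (tripleLaw lam mu J) F
      = ∑ s : Fin m → Bool, (∏ _i : Fin m, (1 / 2 : ℝ)) * expect (tripleLaw lam mu J) F := by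
        rw [← Finset.sum_mul, h2, one_mul]
    _ = ∑ s : Fin m → Bool, (∏ _i : Fin m, (1 / 2 : ℝ)) * expect (tripleLaw lam mu J) fun T =>
          rejectWeight test J (pairWeight Psb Pdb) (fun t : T => exchange n s t.1) :=
        Finset.sum_congr rfl fun s _ => by rw [h1 s]
    _ = expect (tripleLaw lam mu J) fun T => ∑ s : Fin m → Bool, (∏ _i : Fin m, (1 / 2 : ℝ)) *
          rejectWeight test J (pairWeight Psb Pdb) (fun t : T => exchange n s t.1) := by
        simp only [expect, Finset.mul_sum]
        rw [Finset.sum_comm]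
        exact Finset.sum_congr rfl fun T _ => Finset.sum_congr rfl fun s _ => by ring
    _ = _ := expect_congr _ fun T hT =>
        sum_rejectWeight_exchange test J _ (tripleLaw_support hlam hmu hf hT).1

theorem symmWeight_nonneg (Psb Pdb : Matrix (Fin m) (Fin n) unitInterval) (t : Triple m n)
    (z : Bool × Bool) : 0 ≤ symmWeight (pairWeight Psb Pdb) t z :=
  div_nonneg (add_nonneg (mul_nonneg (bern_nonneg _ _) (bern_nonneg _ _))
    (mul_nonneg (bern_nonneg _ _) (bern_nonneg _ _))) two_pos.le

theorem sum_symmWeight (Psb Pdb : Matrix (Fin m) (Fin n) unitInterval) (t : Triple m n) :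
    ∑ z, symmWeight (pairWeight Psb Pdb) t z = 1 := by
  simp only [symmWeight, pairWeight, bern, Fintype.sum_prod_type, Fintype.sum_bool, if_true,
    Bool.false_eq_true, if_false]
  ring

/-- The two orders contribute SB minus DB across different reviewers. Their sum regroups into gaps
of a single reviewer, which is what the hypotheses control. -/
theorem sum_symmWeight_mul_dec_sub (Psb Pdb : Matrix (Fin m) (Fin n) unitInterval)
    (t : Triple m n) :
    ∑ z, symmWeight (pairWeight Psb Pdb) t z * (dec z.1 - dec z.2) =
      (((Psb t.1 t.2.1 : ℝ) - Pdb t.1 t.2.1) + ((Psb t.2.2 t.2.1 : ℝ) - Pdb t.2.2 t.2.1)) / 2 := by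
  simp only [symmWeight, pairWeight, bern, Fintype.sum_prod_type, Fintype.sum_bool, if_true,
    Bool.false_eq_true, if_false, dec, swapTriple]
  ring

/-! ## The two properties of the tests -/

/-- Given the triples, the symmetrized law of the decisions is invariant under swapping any pairs,
so the rejection probability is an average of levels under random swaps. -/
theorem controlsTypeI_of_swapLevel {lam mu : ℕ} (hlam : 1 ≤ lam) (hmu : 1 ≤ mu) {α : ℝ}
    {test : StatTest} (ht : IsReindexInvariant test) (hα : HasSwapLevel α test) :
    ControlsTypeI lam mu α test := by
  classical
  intro m n _ hf J Psb Pdb hnull B hB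
  rw [rejectProb_eq_expect_symm hlam hmu hf J hB ht, ← expect_const (tripleLaw lam mu J) α]
  refine expect_mono _ fun T _ => ?_
  set W := symmWeight (pairWeight Psb Pdb)
  have hW0 : ∀ t z, 0 ≤ W t z := symmWeight_nonneg Psb Pdb
  -- With `Psb = Pdb`, exchanging the decisions amounts to exchanging the reviewers, over which
  -- `symmWeight` averages.
  have hsymm : ∀ t z, W t z.swap = W t z := fun t z => by
    simp only [W, symmWeight, pairWeight, swapTriple, if_true, Prod.fst_swap, Prod.snd_swap,
      hnull _ _]
    ring
  let flip : (T → Bool) → (T → Bool × Bool) ≃ (T → Bool × Bool) := fun s =>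
    Equiv.piCongrRight fun t => if s t then Equiv.prodComm Bool Bool else Equiv.refl _
  have hflip : ∀ s z t, flip s z t = if s t then (z t).swap else z t := fun s z t => by
    cases h : s t <;> simp [flip, h]
  have hfam : ∀ s z, familyTuples J (fun t : T => t.1) (flip s z) =
      fun t => swapAt (s t) (familyTuples J (fun t : T => t.1) z t) := fun s z => by
    funext t
    cases h : s t <;> simp [familyTuples, hflip, h, swapAt]
  have hW : ∀ s z, ∏ t : T, W t.1 (flip s z t) = ∏ t : T, W t.1 (z t) := fun s z => by
    refine Finset.prod_congr rfl fun t _ => ?_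
    rw [hflip]
    split_ifs
    · exact hsymm _ _
    · rfl
  have h1 : ∀ s : T → Bool, rejectWeight test J W (fun t : T => t.1) =
      ∑ z : T → Bool × Bool, (∏ t, W t.1 (z t)) *
        if test n T (fun t => swapAt (s t) (familyTuples J (fun t : T => t.1) z t))
          then 1 else 0 := fun s => by
    rw [rejectWeight_eq, ← Equiv.sum_comp (flip s)]
    refine Finset.sum_congr rfl fun z _ => ?_
    rw [hW, hfam]
  have h2 : ∑ s : T → Bool, (∏ _t : T, (1 / 2 : ℝ)) = 1 :=
    sum_prod_eq_one (fun (_ : T) (_ : Bool) => (1 / 2 : ℝ))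
      fun _ => by norm_num [Fintype.sum_bool]
  calc rejectWeight test J W (fun t : T => t.1)
      = ∑ s : T → Bool, (∏ _t : T, (1 / 2 : ℝ)) * rejectWeight test J W (fun t : T => t.1) := by
        rw [← Finset.sum_mul, h2, one_mul]
    _ = ∑ s : T → Bool, (∏ _t : T, (1 / 2 : ℝ)) * ∑ z : T → Bool × Bool, (∏ t, W t.1 (z t)) *
        if test n T (fun t => swapAt (s t) (familyTuples J (fun t : T => t.1) z t))
          then 1 else 0 := Finset.sum_congr rfl fun s _ => by rw [← h1 s]
    _ = ∑ z : T → Bool × Bool, (∏ t, W t.1 (z t)) * ∑ s : T → Bool, (∏ _t : T, (1 / 2 : ℝ)) *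
        if test n T (fun t => swapAt (s t) (familyTuples J (fun t : T => t.1) z t))
          then 1 else 0 := by
        simp only [Finset.mul_sum]
        rw [Finset.sum_comm]
        exact Finset.sum_congr rfl fun z _ => Finset.sum_congr rfl fun s _ => by ring
    _ ≤ ∑ z : T → Bool × Bool, (∏ t, W t.1 (z t)) * α := by
        refine Finset.sum_le_sum fun z _ => mul_le_mul_of_nonneg_left ?_
          (Finset.prod_nonneg fun t _ => hW0 _ _)
        refine le_trans (le_of_eq ?_) (hα n T (familyTuples J (fun t : T => t.1) z))
        exact Finset.sum_congr (by ext; simp) fun s _ => rfl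
    _ = α := by
        rw [← Finset.sum_mul, sum_prod_eq_one (fun t : T => W t.1)
          (fun t => sum_symmWeight Psb Pdb t.1), one_mul]

theorem card_filter_coe {β : Type} (T : Finset β) (p : β → Prop) [DecidablePred p] :
    (Finset.univ.filter fun t : T => p t.1).card = (T.filter p).card := by
  rw [← Finset.card_map (Function.Embedding.subtype _)]
  congr 1
  ext
  simp [and_comm]

theorem exp_neg_le {x ε : ℝ} (hε : 0 < ε) (h : 2 / ε ≤ x) : Real.exp (-x) ≤ ε / 2 := by
  rw [Real.exp_neg, inv_le_comm₀ (Real.exp_pos _) (by positivity), inv_div]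
  linarith [Real.add_one_le_exp x]

theorem nonTrivialPower_of_rejectsBias {lam mu : ℕ} (hlam : 1 ≤ lam) (hmu : 1 ≤ mu)
    {test : StatTest} (ht : IsReindexInvariant test) (hb : RejectsBias test) :
    NonTrivialPower lam mu test := by
  classical
  intro ε hε δ hδ
  -- Truncation at one meets the requirement of `lower_tail`.
  set d := min δ 1 with hd
  have hd0 : 0 < d := lt_min hδ one_pos
  have hd1 : d ≤ 1 := min_le_right _ _
  obtain ⟨K₁, hK₁⟩ := hb d hd0
  obtain ⟨K₂, hK₂⟩ := exists_nat_gt (2 / ε * 16 / d ^ 2)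
  -- Inverting the count in `IsAdmissible`: more papers than this give at least `K₁` triples of each
  -- kind, for rejection, and `K₂`, for each Chernoff error to be at most `ε / 2`.
  refine ⟨max K₁ K₂ * (8 * mu) + 4 * mu, fun m n _ hf J hJ Psb Pdb halt B hB => ?_⟩
  rw [rejectProb_eq_expect_symm hlam hmu hf J hB ht, ← expect_const (tripleLaw lam mu J) (1 - ε)]
  refine expect_mono _ fun T hT => ?_
  obtain ⟨-, hT1, hT2⟩ := tripleLaw_support hlam hmu hf hT
  rw [lt_min_iff] at hJ
  have hcard : ∀ N : ℕ, max K₁ K₂ * (8 * mu) + 4 * mu < N * (8 * mu) + 4 * mu →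
      K₁ ≤ N ∧ K₂ ≤ N := fun N hN =>
    max_le_iff.1 (Nat.lt_of_mul_lt_mul_right (Nat.lt_of_add_lt_add_right hN)).le
  obtain ⟨hU1, hU2⟩ := hcard _ (hJ.1.trans_le hT1)
  obtain ⟨hV1, hV2⟩ := hcard _ (hJ.2.trans_le hT2)
  rw [← card_filter_coe] at hU1 hU2 hV1 hV2
  set U : Finset T := Finset.univ.filter fun t : T => t.1.2.1 ∈ J with hU
  set V : Finset T := Finset.univ.filter fun t : T => t.1.2.1 ∉ J with hV
  set W := symmWeight (pairWeight Psb Pdb)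
  have hW0 : ∀ t z, 0 ≤ W t z := symmWeight_nonneg Psb Pdb
  have hW1 : ∀ t, ∑ z, W t z = 1 := sum_symmWeight Psb Pdb
  have hmU : ∀ t ∈ U, d ≤ ∑ z, W t.1 z * (dec z.1 - dec z.2) := fun t htU => by
    have htJ := (Finset.mem_filter.1 htU).2
    have hgap : ∀ i, d ≤ (Psb i t.1.2.1 : ℝ) - Pdb i t.1.2.1 := fun i => by
      have h1 : (Pdb i t.1.2.1 : ℝ) ≤ Psb i t.1.2.1 := (halt.1.1 i t.1.2.1).1 htJ
      have h2 := halt.2 i t.1.2.1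
      rw [abs_of_nonneg (by linarith)] at h2
      exact (min_le_left _ _).trans h2.le
    rw [sum_symmWeight_mul_dec_sub]
    linarith [hgap t.1.1, hgap t.1.2.2]
  have hmV : ∀ t ∈ V, d ≤ ∑ z, W t.1 z * (dec z.2 - dec z.1) := fun t htV => by
    have htJ := (Finset.mem_filter.1 htV).2
    have hgap : ∀ i, (Psb i t.1.2.1 : ℝ) - Pdb i t.1.2.1 ≤ -d := fun i => by
      have h1 : (Psb i t.1.2.1 : ℝ) ≤ Pdb i t.1.2.1 := (halt.1.1 i t.1.2.1).2 htJ
      have h2 := halt.2 i t.1.2.1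
      rw [abs_of_nonpos (by linarith)] at h2
      linarith [min_le_left δ 1]
    have : ∑ z, W t.1 z * (dec z.2 - dec z.1) = -∑ z, W t.1 z * (dec z.1 - dec z.2) := by
      rw [← Finset.sum_neg_distrib]
      exact Finset.sum_congr rfl fun z _ => by ring
    rw [this, sum_symmWeight_mul_dec_sub]
    linarith [hgap t.1.1, hgap t.1.2.2]
  have hbU := lower_tail (fun t : T => W t.1) (fun t z => hW0 t.1 z) (fun t => hW1 t.1)
    (fun _ z => dec z.1 - dec z.2) (fun _ z => abs_dec_sub_le _ _) U hd0 hd1 hmU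
  have hbV := lower_tail (fun t : T => W t.1) (fun t z => hW0 t.1 z) (fun t => hW1 t.1)
    (fun _ z => dec z.2 - dec z.1) (fun _ z => abs_dec_sub_le _ _) V hd0 hd1 hmV
  have hexp : ∀ N : ℕ, K₂ ≤ N → Real.exp (-(d ^ 2 / 16 * N)) ≤ ε / 2 := fun N hN => by
    refine exp_neg_le hε ?_
    have : (K₂ : ℝ) ≤ N := by exact_mod_cast hN
    rw [div_lt_iff₀ (by positivity)] at hK₂
    nlinarith [mul_le_mul_of_nonneg_left this (sq_nonneg d)]
  have hw : ∀ z (t : T), (familyTuples J (fun t : T => t.1) z t).w = 1 ↔ t.1.2.1 ∈ J := fun z t => by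
    by_cases h : t.1.2.1 ∈ J <;> simp [familyTuples, h]
  have hw' : ∀ z (t : T), (familyTuples J (fun t : T => t.1) z t).w = -1 ↔ t.1.2.1 ∉ J :=
    fun z t => by
      by_cases h : t.1.2.1 ∈ J <;> simp [familyTuples, h]
  -- Union bound: the test rejects unless one of the two sums falls short.
  have hind : ∀ z : T → Bool × Bool,
      1 - (if ∑ t ∈ U, (dec (z t).1 - dec (z t).2) < d / 2 * U.card then (1 : ℝ) else 0) -
        (if ∑ t ∈ V, (dec (z t).2 - dec (z t).1) < d / 2 * V.card then (1 : ℝ) else 0) ≤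
      if test n T (familyTuples J (fun t : T => t.1) z) then 1 else 0 := fun z => by
    by_cases h1 : ∑ t ∈ U, (dec (z t).1 - dec (z t).2) < d / 2 * U.card
    · rw [if_pos h1]
      split_ifs <;> norm_num
    by_cases h2 : ∑ t ∈ V, (dec (z t).2 - dec (z t).1) < d / 2 * V.card
    · rw [if_pos h2]
      split_ifs <;> norm_num
    have : test n T (familyTuples J (fun t : T => t.1) z) := by
      apply hK₁ <;> simp only [hw, hw']
      · exact hU1
      · exact hV1
      · exact not_lt.1 h1
      · exact not_lt.1 h2
    rw [if_neg h1, if_neg h2, if_pos this]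
    norm_num
  have htot : ∑ z : T → Bool × Bool, ∏ t, W t.1 (z t) = 1 :=
    sum_prod_eq_one (fun t : T => W t.1) fun t => hW1 t.1
  have hfinal := Finset.sum_le_sum fun (z : T → Bool × Bool) (_ : z ∈ Finset.univ) =>
    mul_le_mul_of_nonneg_left (hind z)
      (Finset.prod_nonneg fun t _ => hW0 t.1 (z t) : (0 : ℝ) ≤ ∏ t, W t.1 (z t))
  have hsplit : ∀ a b : (T → Bool × Bool) → ℝ, ∑ z : T → Bool × Bool, (∏ t, W t.1 (z t)) *
      (1 - a z - b z) = 1 - ∑ z : T → Bool × Bool, (∏ t, W t.1 (z t)) * a z -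
        ∑ z : T → Bool × Bool, (∏ t, W t.1 (z t)) * b z := fun a b => by
    conv_rhs => rw [← htot]
    rw [← Finset.sum_sub_distrib, ← Finset.sum_sub_distrib]
    exact Finset.sum_congr rfl fun z _ => by ring
  rw [hsplit] at hfinal
  rw [rejectWeight_eq]
  linarith [hexp U.card hU2, hexp V.card hV2]

end

end PeerReview

theorem proposition2 (lam mu : ℕ) (hlam : 1 ≤ lam) (hmu : 1 ≤ mu)
    (α : ℝ) (hα₀ : 0 < α) (hα₁ : α < 1) :
    (PeerReview.ControlsTypeI lam mu α (PeerReview.disagreementTest α) ∧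
      PeerReview.NonTrivialPower lam mu (PeerReview.disagreementTest α)) ∧
    (PeerReview.ControlsTypeI lam mu α (PeerReview.countingTest α) ∧
      PeerReview.NonTrivialPower lam mu (PeerReview.countingTest α)) :=
  ⟨⟨PeerReview.controlsTypeI_of_swapLevel hlam hmu (PeerReview.disagreementTest_reindex α)
      (PeerReview.disagreementTest_swapLevel hα₀.le),
    PeerReview.nonTrivialPower_of_rejectsBias hlam hmu (PeerReview.disagreementTest_reindex α)
      (PeerReview.disagreementTest_rejectsBias hα₀)⟩,
   ⟨PeerReview.controlsTypeI_of_swapLevel hlam hmu (PeerReview.countingTest_reindex α)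
      (PeerReview.countingTest_swapLevel hα₀ hα₁),
    PeerReview.nonTrivialPower_of_rejectsBias hlam hmu (PeerReview.countingTest_reindex α)
      (PeerReview.countingTest_rejectsBias hα₀ hα₁)⟩⟩
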